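/- Model. A quantum program for the dimensions $(l,m,n)$ is a flowchart acting on a fixed finite number of qubits initialised to $|0\cdots0\rangle$. Its instructions are the elementary gates $X$, $H$, $T$, CNOT and Toffoli, the application of a preparation unitary of $A$ or $B$ or of its inverse, the measurement of one qubit followed by branching on the outcome, and halting. Gates and measurements cost one unit of time each, and each use of a preparation unitary or its inverse costs $\tau\ge 1$ units. For an $l\times m$ matrix $A$ the preparation unitaries are any three unitaries, acting on two registers of $\lceil\log_2 l\rceil$ and $\lceil\log_2 m\rceil$ qubits, that satisfy $$|0\rangle|0\rangle\mapsto|A\rangle:=\frac1{\|A\|_F}\sum_{i,j}a_{ij}|i\rangle|j\rangle,\qquad |i\rangle|0\rangle\mapsto|i\rangle|A_{i\bullet}\rangle,\qquad |0\rangle|j\rangle\mapsto|A_{\bullet j}\rangle|j\rangle,$$ respectively, where $|A_{i\bullet}\rangle$ and $|A_{\bullet j}\rangle$ are the normalized $i$-th row and $j$-th column; the last two are required only for nonzero rows and columns, and nothing is required on other inputs. The same holds for $B$. Theorem. There are absolute constants $C>0$ and $k\in\mathbb N$ such that for all $l,m,n$ with $ln\ne1$ and all $0<\epsilon<1$ there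 is a quantum program, depending only on $l,m,n,\epsilon$, with the following property. Let $A$ be a real or complex $l\times m$ matrix and $B$ a real or complex $m\times n$ matrix with $AB\neq0$, and let preparation unitaries of $A$ and of $B$ be given, each use of which costs $\tau\ge1$. Then 1. whenever the program halts, its normalized final state is within Euclidean distance $\epsilon$ of $|AB\rangle\otimes|g\rangle$ for some unit vector $|g\rangle$ on the qubits outside the output register, where $|AB\rangle=\frac1{\|AB\|_F}\sum_{i,j}(AB)_{ij}|i\rangle|j\rangle$; and 2. with probability at least $1-\epsilon$ the program halts within time $$C\,\tau\,\Bigl(\log\frac{lmn}{\epsilon}\Bigr)^{k}\,\frac{\|A\|_F\|B\|_F}{\|AB\|_F\,\epsilon}.$$ In particular, if the preparation unitaries are efficient, that is, $\tau$ is polylogarithmic in $l,m,n$, then $|AB\rangle$ is obtained to accuracy $\epsilon$ in time $\widetilde O\bigl(\|A\|_F\|B\|_F/(\|AB\|_F\,\epsilon)\bigr)$, where $\widetilde O$ hides factors polylogarithmic in $l,m,n,1/\epsilon$. -/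

import Mathlib

/-!
A gate-level model of quantum programs that have access to state-preparation unitaries of two
matrices `A` (of size `l × m`) and `B` (of size `m × n`).  States of `q` qubits are functions
`(Fin q → Bool) → ℂ`; they are kept unnormalised along measurement branches, so that the squared
norm of a branch is its probability.
-/

noncomputable section

namespace QMatMul

/-- The Euclidean norm of a complex vector. -/
def l2norm {ι : Type} [Fintype ι] (v : ι → ℂ) : ℝ :=
  ‖(WithLp.toLp 2 v : EuclideanSpace ℂ ι)‖

/-- The Frobenius norm of a matrix. -/
def frobNorm {l m : ℕ} (A : Matrix (Fin l) (Fin m) ℂ) : ℝ :=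
  l2norm (fun p : Fin l × Fin m => A p.1 p.2)

/-- The computational basis state `|x⟩`. -/
def ket {κ : Type} [Fintype κ] [DecidableEq κ] (x : κ → Bool) : (κ → Bool) → ℂ :=
  Pi.single x 1

/-- Qubits of a pair of registers that hold indices below `l` and below `m` in binary. -/
abbrev Reg (l m : ℕ) : Type := Fin (Nat.clog 2 l) ⊕ Fin (Nat.clog 2 m)

/-- The basis state `|i⟩|j⟩` of the pair of registers. -/
def ketPair (l m i j : ℕ) : (Reg l m → Bool) → ℂ :=
  ket (Sum.elim (fun t => Nat.testBit i t) (fun t => Nat.testBit j t))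

/-- The state `|A⟩ = ‖A‖_F⁻¹ ∑ i j, A i j |i⟩|j⟩` (used for `A ≠ 0`). -/
def matrixState {l m : ℕ} (A : Matrix (Fin l) (Fin m) ℂ) : (Reg l m → Bool) → ℂ :=
  ∑ i : Fin l, ∑ j : Fin m, (A i j / (frobNorm A : ℂ)) • ketPair l m i j

/-- The state `|i⟩|A_{i•}⟩` for the `i`-th row of `A` (used for nonzero rows). -/
def rowState {l m : ℕ} (A : Matrix (Fin l) (Fin m) ℂ) (i : Fin l) : (Reg l m → Bool) → ℂ :=
  ∑ j : Fin m, (A i j / (l2norm (fun j' => A i j') : ℂ)) • ketPair l m i j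

/-- The state `|A_{•j}⟩|j⟩` for the `j`-th column of `A` (used for nonzero columns). -/
def colState {l m : ℕ} (A : Matrix (Fin l) (Fin m) ℂ) (j : Fin m) : (Reg l m → Bool) → ℂ :=
  ∑ i : Fin l, (A i j / (l2norm (fun i' => A i' j) : ℂ)) • ketPair l m i j

/-- The three kinds of preparation unitaries of a matrix. -/
inductive Prep
  | whole
  | row
  | col

/-- Square matrices that act on the pair of registers, one for each kind of preparation. -/
abbrev PrepUnitaries (l m : ℕ) : Type :=
  Prep → Matrix (Reg l m → Bool) (Reg l m → Bool) ℂ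

/-- `U` consists of unitaries that prepare `A`, its rows and its columns:
`|0⟩|0⟩ ↦ |A⟩`, `|i⟩|0⟩ ↦ |i⟩|A_{i•}⟩` and `|0⟩|j⟩ ↦ |A_{•j}⟩|j⟩`.
Nothing is required on other inputs, nor for rows and columns that vanish. -/
structure Prepares {l m : ℕ} (U : PrepUnitaries l m) (A : Matrix (Fin l) (Fin m) ℂ) : Prop where
  unitary : ∀ p, U p ∈ Matrix.unitaryGroup (Reg l m → Bool) ℂ
  whole : (U .whole).mulVec (ketPair l m 0 0) = matrixState A
  row : ∀ i : Fin l, (∃ j, A i j ≠ 0) → (U .row).mulVec (ketPair l m i 0) = rowState A i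
  col : ∀ j : Fin m, (∃ i, A i j ≠ 0) → (U .col).mulVec (ketPair l m 0 j) = colState A j

/-- The elementary gates: a fixed finite universal set. -/
inductive Gate
  | X
  | H
  | T
  | CNOT
  | Toffoli

/-- The number of qubits a gate acts on. -/
abbrev Gate.arity : Gate → ℕ
  | .X => 1
  | .H => 1
  | .T => 1
  | .CNOT => 2
  | .Toffoli => 3

/-- The unitary matrix of a gate; the last qubit of `CNOT` and of `Toffoli` is the target. -/
def Gate.matrix : (g : Gate) → Matrix (Fin g.arity → Bool) (Fin g.arity → Bool) ℂ
  | .X => Matrix.of fun (x y : Fin 1 → Bool) => if x 0 = !(y 0) then 1 else 0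
  | .H => Matrix.of fun (x y : Fin 1 → Bool) =>
      (if x 0 && y 0 then -1 else 1) / (Real.sqrt 2 : ℂ)
  | .T => Matrix.of fun (x y : Fin 1 → Bool) =>
      if x 0 = y 0 then (if x 0 then Complex.exp (Complex.I * Real.pi / 4) else 1) else 0
  | .CNOT => Matrix.of fun (x y : Fin 2 → Bool) =>
      if x 0 = y 0 ∧ x 1 = xor (y 1) (y 0) then 1 else 0
  | .Toffoli => Matrix.of fun (x y : Fin 3 → Bool) =>
      if x 0 = y 0 ∧ x 1 = y 1 ∧ x 2 = xor (y 2) (y 0 && y 1) then 1 else 0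

/-- Apply the matrix `U` to the qubits selected by `e` and the identity to all other qubits. -/
def applyOn {κ : Type} [Fintype κ] [DecidableEq κ] {q : ℕ} (e : κ ↪ Fin q)
    (U : Matrix (κ → Bool) (κ → Bool) ℂ) (ψ : (Fin q → Bool) → ℂ) : (Fin q → Bool) → ℂ :=
  fun x => ∑ y : κ → Bool, U (fun k => x (e k)) y * ψ (Function.extend e y x)

/-- Instructions of a program on `q` qubits whose control locations form the type `Loc`.
`prepA p inv` and `prepB p inv` call a preparation unitary of the first and of the second matrix,
or its inverse if `inv` is true; `measure` reads one qubit and branches on the outcome. -/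
inductive Instr (l m n q : ℕ) (Loc : Type)
  | gate (g : Gate) (e : Fin g.arity ↪ Fin q) (next : Loc)
  | prepA (p : Prep) (inv : Bool) (e : Reg l m ↪ Fin q) (next : Loc)
  | prepB (p : Prep) (inv : Bool) (e : Reg m n ↪ Fin q) (next : Loc)
  | measure (i : Fin q) (next : Bool → Loc)
  | halt

/-- A quantum program for matrices of sizes `l × m` and `m × n`: a flowchart of instructions on
`qubits` qubits, whose output register (for states indexed by `l × n`) is selected by `out`. -/
structure Program (l m n : ℕ) where
  qubits : ℕ
  Loc : Type
  start : Loc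
  instr : Loc → Instr l m n qubits Loc
  out : Reg l n ↪ Fin qubits

/-- A branch of the execution: control location, unnormalised state, and time used so far. -/
structure Config (q : ℕ) (Loc : Type) where
  loc : Loc
  state : (Fin q → Bool) → ℂ
  time : ℝ

namespace Program

variable {l m n : ℕ} (P : Program l m n)

/-- The successors of a branch.  Gates and measurements take one unit of time; each use of a
preparation unitary or of its inverse takes time `τ`.  A halted branch stays as it is. -/
def succs (UA : PrepUnitaries l m) (UB : PrepUnitaries m n) (τ : ℝ)
    (c : Config P.qubits P.Loc) : List (Config P.qubits P.Loc) :=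
  match P.instr c.loc with
  | .gate g e next => [⟨next, applyOn e g.matrix c.state, c.time + 1⟩]
  | .prepA p inv e next =>
      [⟨next, applyOn e (if inv then (UA p).conjTranspose else UA p) c.state, c.time + τ⟩]
  | .prepB p inv e next =>
      [⟨next, applyOn e (if inv then (UB p).conjTranspose else UB p) c.state, c.time + τ⟩]
  | .measure i next =>
      [⟨next false, fun x => if x i = false then c.state x else 0, c.time + 1⟩,
       ⟨next true, fun x => if x i = true then c.state x else 0, c.time + 1⟩]
  | .halt => [c]

/-- All branches after `N` steps, starting from `|0…0⟩`. -/
def branches (UA : PrepUnitaries l m) (UB : PrepUnitaries m n) (τ : ℝ) :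
    ℕ → List (Config P.qubits P.Loc)
  | 0 => [⟨P.start, ket (fun _ => false), 0⟩]
  | N + 1 => (branches UA UB τ N).flatMap (P.succs UA UB τ)

/-- The branch has halted. -/
def Halted (c : Config P.qubits P.Loc) : Prop := P.instr c.loc = .halt

open Classical in
/-- The probability that the program halts within `N` steps and within time `T`. -/
def haltProb (UA : PrepUnitaries l m) (UB : PrepUnitaries m n) (τ : ℝ) (N : ℕ) (T : ℝ) : ℝ :=
  ((P.branches UA UB τ N).map
    (fun c => if P.Halted c ∧ c.time ≤ T then l2norm c.state ^ 2 else 0)).sum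

end Program

/-- After normalisation, the state `ψ` of `q` qubits is within Euclidean distance `ε` of the
state `φ` on the qubits selected by `out`, tensored with some unit vector `g` on the others. -/
def ApproxOn {κ : Type} [Fintype κ] [DecidableEq κ] {q : ℕ} (out : κ ↪ Fin q)
    (φ : (κ → Bool) → ℂ) (ε : ℝ) (ψ : (Fin q → Bool) → ℂ) : Prop :=
  ∃ g : ({i : Fin q // ∀ k, out k ≠ i} → Bool) → ℂ, l2norm g = 1 ∧
    l2norm (fun x => ψ x - (l2norm ψ : ℂ) * (φ (fun k => x (out k)) * g (fun i => x i)))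
      ≤ ε * l2norm ψ

end QMatMul

end

noncomputable section

namespace QMatMul

/-! ### The Euclidean norm and matrices applied to selected qubits -/

/-! The proof gives a circuit whose postselected output is exactly the product state, and amplifies
it without knowing its amplitude.

On registers for a row, a copy of the inner index, an auxiliary row, the inner index and a column
(`mulOps`), first prepare `|B⟩` on inner index and column, copy the inner index `j`, apply the
column preparation of `A` to row and inner index, and undo the copy. Then apply the column
preparation and the inverse of the whole preparation of `A` to the auxiliary row and inner index.
Since `|A⟩ = ∑ j, w j |A_{•j}⟩|j⟩` with `w j = ‖A_{•j}‖ / ‖A‖_F`, these last two unitaries contract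
an amplitude at `|0⟩|j⟩` with the weight `w j`, and `w j` restores the norm lost by normalizing the
column. The amplitude at `|i⟩|k⟩`, all else zero, is `(A * B) i k / (‖A‖_F ‖B‖_F)`
(`amplitude_mulOps`). The copy is needed because the column unitary is unconstrained on vanishing
columns: any change of the inner index leaves a nonzero copy register, and if the index is unchanged
the weight is zero.

Hence the part of the state whose non-output qubits vanish has norm `a = ‖AB‖_F / (‖A‖_F ‖B‖_F) =
sin θ` and is proportional to `|AB⟩` (`projList_mulState`). After `r` rounds of amplitude
amplification the success probability is `sin² ((2r+1)θ)`, while the successful part keeps its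
direction (`l2norm_amplify`).

As `θ` is unknown, the rounds are chosen with `2r+1 = 3^t` for `t = 0, 1, …`, each `t` being tried
`R = O(log (1/ε))` times. Tripling cannot jump over `(π/6, π/2]`, so some `t` succeeds with
probability at least `1/4` per try (`exists_three_pow`), and all `R` tries fail with probability at
most `(3/4)^R ≤ ε`. The costs form a geometric series dominated by `3^t ≤ 2 / sin θ`
(`attempts_haltsBy`). Failed tries are followed by a reset of all qubits, and the program halts only
after a successful test, in an exact multiple of the target state. -/

theorem l2norm_sq {ι : Type} [Fintype ι] (v : ι → ℂ) : l2norm v ^ 2 = ∑ x, ‖v x‖ ^ 2 := by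
  simp [l2norm, EuclideanSpace.norm_sq_eq]

theorem l2norm_nonneg {ι : Type} [Fintype ι] (v : ι → ℂ) : 0 ≤ l2norm v := norm_nonneg _

theorem l2norm_smul {ι : Type} [Fintype ι] (c : ℂ) (v : ι → ℂ) :
    l2norm (c • v) = ‖c‖ * l2norm v := by
  simp [l2norm, norm_smul]

theorem l2norm_eq_zero {ι : Type} [Fintype ι] {v : ι → ℂ} : l2norm v = 0 ↔ v = 0 := by
  simp [l2norm]

theorem l2norm_ket {κ : Type} [Fintype κ] [DecidableEq κ] (x : κ → Bool) :
    l2norm (ket x) = 1 := by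
  have h : l2norm (ket x) ^ 2 = 1 := by
    rw [l2norm_sq, Finset.sum_eq_single x]
    · simp [ket]
    · intro y _ hy
      simp [ket, hy]
    · simp
  have := l2norm_nonneg (ket x)
  nlinarith

section ApplyOn

variable {κ : Type} {q : ℕ} (e : κ ↪ Fin q)

theorem extend_extend (y z : κ → Bool) (x : Fin q → Bool) :
    Function.extend e y (Function.extend e z x) = Function.extend e y x := by
  funext i
  by_cases h : ∃ k, e k = i
  · obtain ⟨k, rfl⟩ := h
    simp [e.injective.extend_apply]
  · simp [Function.extend_apply' _ _ _ h]

theorem extend_self (x : Fin q → Bool) : Function.extend e (fun k => x (e k)) x = x := by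
  funext i
  by_cases h : ∃ k, e k = i
  · obtain ⟨k, rfl⟩ := h
    simp [e.injective.extend_apply]
  · simp [Function.extend_apply' _ _ _ h]

variable [Fintype κ] [DecidableEq κ]

theorem applyOn_applyOn (U W : Matrix (κ → Bool) (κ → Bool) ℂ) (ψ : (Fin q → Bool) → ℂ) :
    applyOn e U (applyOn e W ψ) = applyOn e (U * W) ψ := by
  funext x
  simp only [applyOn, extend_extend, e.injective.extend_apply, Matrix.mul_apply, Finset.mul_sum,
    Finset.sum_mul]
  rw [Finset.sum_comm]
  simp only [mul_assoc]

theorem applyOn_one (ψ : (Fin q → Bool) → ℂ) : applyOn e 1 ψ = ψ := by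
  funext x
  simp [applyOn, Matrix.one_apply, extend_self]

theorem applyOn_add (U : Matrix (κ → Bool) (κ → Bool) ℂ) (φ ψ : (Fin q → Bool) → ℂ) :
    applyOn e U (φ + ψ) = applyOn e U φ + applyOn e U ψ := by
  funext x
  simp [applyOn, mul_add, Finset.sum_add_distrib]

theorem applyOn_smul (U : Matrix (κ → Bool) (κ → Bool) ℂ) (c : ℂ) (ψ : (Fin q → Bool) → ℂ) :
    applyOn e U (c • ψ) = c • applyOn e U ψ := by
  funext x
  simp [applyOn, Finset.mul_sum, mul_left_comm]

/-- The sesquilinear pairing `⟨φ, ψ⟩`. -/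
def pairing {ι : Type} [Fintype ι] (φ ψ : ι → ℂ) : ℂ := ∑ x, star (φ x) * ψ x

/-- Exchanging the selected bits of `x` with the summation index `y` is an involution on pairs `(x,
y)`; reindexing the double sum by it moves the matrix to the other argument. -/
theorem pairing_applyOn (U : Matrix (κ → Bool) (κ → Bool) ℂ) (φ ψ : (Fin q → Bool) → ℂ) :
    pairing φ (applyOn e U ψ) = pairing (applyOn e U.conjTranspose φ) ψ := by
  simp only [pairing, applyOn, star_sum, star_mul', Matrix.conjTranspose_apply, star_star,
    Finset.mul_sum, Finset.sum_mul]
  rw [← Fintype.sum_prod_type', ← Fintype.sum_prod_type']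
  let f : (Fin q → Bool) × (κ → Bool) → (Fin q → Bool) × (κ → Bool) :=
    fun p => (Function.extend e p.2 p.1, fun k => p.1 (e k))
  have hf : Function.Involutive f := by
    rintro ⟨x, y⟩
    simp [f, extend_extend, extend_self, e.injective.extend_apply]
  refine Fintype.sum_equiv hf.toPerm _ _ ?_
  rintro ⟨x, y⟩
  simp only [Function.Involutive.coe_toPerm, f, extend_extend, extend_self,
    e.injective.extend_apply]
  ring

end ApplyOn

/-! ### Instructions without control flow -/

/-- A unitary instruction, without its successor location. -/
inductive Op (l m n q : ℕ)
  | gate (g : Gate) (e : Fin g.arity ↪ Fin q)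
  | prepA (p : Prep) (inv : Bool) (e : Reg l m ↪ Fin q)
  | prepB (p : Prep) (inv : Bool) (e : Reg m n ↪ Fin q)

namespace Op

variable {l m n q : ℕ} (UA : PrepUnitaries l m) (UB : PrepUnitaries m n)

/-- The action of an instruction on states. -/
def apply : Op l m n q → ((Fin q → Bool) → ℂ) → ((Fin q → Bool) → ℂ)
  | .gate g e => applyOn e g.matrix
  | .prepA p inv e => applyOn e (if inv then (UA p).conjTranspose else UA p)
  | .prepB p inv e => applyOn e (if inv then (UB p).conjTranspose else UB p)

/-- The action of a list of instructions, the head of the list first. -/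
def applyList (L : List (Op l m n q)) (ψ : (Fin q → Bool) → ℂ) : (Fin q → Bool) → ℂ :=
  L.foldl (fun φ o => o.apply UA UB φ) ψ

/-- The time taken by an instruction. -/
def cost (τ : ℝ) : Op l m n q → ℝ
  | .gate _ _ => 1
  | .prepA _ _ _ => τ
  | .prepB _ _ _ => τ

/-- The time taken by a list of instructions. -/
def costList (τ : ℝ) (L : List (Op l m n q)) : ℝ := (L.map (cost τ)).sum

/-- The inverse instruction; gates are taken to be self-inverse. -/
def inv : Op l m n q → Op l m n q
  | .gate g e => .gate g e
  | .prepA p b e => .prepA p (!b) e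
  | .prepB p b e => .prepB p (!b) e

/-- The inverse of a list of instructions. -/
def invList (L : List (Op l m n q)) : List (Op l m n q) := (L.map inv).reverse

@[simp] theorem applyList_nil (ψ : (Fin q → Bool) → ℂ) :
    applyList UA UB ([] : List (Op l m n q)) ψ = ψ := rfl

@[simp] theorem applyList_cons (o : Op l m n q) (L : List (Op l m n q)) (ψ : (Fin q → Bool) → ℂ) :
    applyList UA UB (o :: L) ψ = applyList UA UB L (o.apply UA UB ψ) := rfl

@[simp] theorem applyList_append (L M : List (Op l m n q)) (ψ : (Fin q → Bool) → ℂ) :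
    applyList UA UB (L ++ M) ψ = applyList UA UB M (applyList UA UB L ψ) := by
  simp [applyList]

@[simp] theorem costList_nil (τ : ℝ) : costList τ ([] : List (Op l m n q)) = 0 := rfl

@[simp] theorem costList_cons (τ : ℝ) (o : Op l m n q) (L : List (Op l m n q)) :
    costList τ (o :: L) = o.cost τ + costList τ L := by simp [costList]

@[simp] theorem costList_append (τ : ℝ) (L M : List (Op l m n q)) :
    costList τ (L ++ M) = costList τ L + costList τ M := by simp [costList]

@[simp] theorem cost_inv (τ : ℝ) (o : Op l m n q) : o.inv.cost τ = o.cost τ := by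
  cases o <;> rfl

@[simp] theorem costList_invList (τ : ℝ) (L : List (Op l m n q)) :
    costList τ (invList L) = costList τ L := by
  simp [costList, invList, List.sum_reverse, Function.comp_def]

@[simp] theorem inv_inv (o : Op l m n q) : o.inv.inv = o := by
  cases o <;> simp [inv]

theorem invList_invList (L : List (Op l m n q)) : invList (invList L) = L := by
  simp [invList, Function.comp_def]

theorem apply_smul (o : Op l m n q) (c : ℂ) (ψ : (Fin q → Bool) → ℂ) :
    o.apply UA UB (c • ψ) = c • o.apply UA UB ψ := by
  cases o <;> simp [apply, applyOn_smul]

theorem apply_add (o : Op l m n q) (φ ψ : (Fin q → Bool) → ℂ) :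
    o.apply UA UB (φ + ψ) = o.apply UA UB φ + o.apply UA UB ψ := by
  cases o <;> simp [apply, applyOn_add]

theorem applyList_smul (L : List (Op l m n q)) (c : ℂ) (ψ : (Fin q → Bool) → ℂ) :
    applyList UA UB L (c • ψ) = c • applyList UA UB L ψ := by
  induction L generalizing ψ with
  | nil => rfl
  | cons o L ih => simp [apply_smul, ih]

theorem applyList_add (L : List (Op l m n q)) (φ ψ : (Fin q → Bool) → ℂ) :
    applyList UA UB L (φ + ψ) = applyList UA UB L φ + applyList UA UB L ψ := by
  induction L generalizing φ ψ with
  | nil => rfl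
  | cons o L ih => simp [apply_add, ih]

/-- The instruction does not touch the qubit `i`. -/
def Avoids (i : Fin q) : Op l m n q → Prop
  | .gate _ e => ∀ k, e k ≠ i
  | .prepA _ _ e => ∀ k, e k ≠ i
  | .prepB _ _ e => ∀ k, e k ≠ i

/-- An untouched qubit that is zero stays zero. This keeps the ancillas clean between reflections.
-/
theorem apply_eq_zero_of_avoids {o : Op l m n q} {i : Fin q} (ho : o.Avoids i)
    {ψ : (Fin q → Bool) → ℂ} (hψ : ∀ x, x i = true → ψ x = 0) (x : Fin q → Bool)
    (hx : x i = true) : o.apply UA UB ψ x = 0 := by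
  cases o <;>
  · refine Finset.sum_eq_zero fun y _ => ?_
    rw [hψ _ (by rw [Function.extend_apply' _ _ _ (not_exists.2 ho)]; exact hx), mul_zero]

theorem applyList_eq_zero_of_avoids {L : List (Op l m n q)} {i : Fin q}
    (hL : ∀ o ∈ L, o.Avoids i) {ψ : (Fin q → Bool) → ℂ} (hψ : ∀ x, x i = true → ψ x = 0)
    (x : Fin q → Bool) (hx : x i = true) : applyList UA UB L ψ x = 0 := by
  induction L generalizing ψ with
  | nil => exact hψ x hx
  | cons o L ih =>
    exact ih (fun o' h => hL o' (by simp [h]))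
      (apply_eq_zero_of_avoids UA UB (hL o (by simp)) hψ)

theorem avoids_inv {o : Op l m n q} {i : Fin q} (h : o.Avoids i) : o.inv.Avoids i := by
  cases o <;> exact h

theorem avoids_invList {L : List (Op l m n q)} {i : Fin q} (h : ∀ o ∈ L, o.Avoids i) :
    ∀ o ∈ invList L, o.Avoids i := by
  intro o ho
  simp only [invList, List.mem_reverse, List.mem_map] at ho
  obtain ⟨o', h', rfl⟩ := ho
  exact avoids_inv (h o' h')

/-- `o.inv` acts as the adjoint and the inverse of `o`. -/
structure IsUnitary (o : Op l m n q) : Prop where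
  inv_apply : ∀ ψ, o.inv.apply UA UB (o.apply UA UB ψ) = ψ
  apply_inv : ∀ ψ, o.apply UA UB (o.inv.apply UA UB ψ) = ψ
  adjoint : ∀ φ ψ, pairing φ (o.apply UA UB ψ) = pairing (o.inv.apply UA UB φ) ψ
  adjoint_inv : ∀ φ ψ, pairing φ (o.inv.apply UA UB ψ) = pairing (o.apply UA UB φ) ψ

variable {UA UB}

theorem IsUnitary.prepA (hU : ∀ p, UA p ∈ Matrix.unitaryGroup (Reg l m → Bool) ℂ) (p : Prep)
    (b : Bool) (e : Reg l m ↪ Fin q) : IsUnitary UA UB (.prepA p b e : Op l m n q) := by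
  have h1 := Matrix.mem_unitaryGroup_iff.1 (hU p)
  have h2 := Matrix.mem_unitaryGroup_iff'.1 (hU p)
  rw [Matrix.star_eq_conjTranspose] at h1 h2
  constructor <;> cases b <;>
    simp [apply, inv, applyOn_applyOn, h1, h2, applyOn_one, pairing_applyOn]

theorem IsUnitary.prepB (hU : ∀ p, UB p ∈ Matrix.unitaryGroup (Reg m n → Bool) ℂ) (p : Prep)
    (b : Bool) (e : Reg m n ↪ Fin q) : IsUnitary UA UB (.prepB p b e : Op l m n q) := by
  have h1 := Matrix.mem_unitaryGroup_iff.1 (hU p)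
  have h2 := Matrix.mem_unitaryGroup_iff'.1 (hU p)
  rw [Matrix.star_eq_conjTranspose] at h1 h2
  constructor <;> cases b <;>
    simp [apply, inv, applyOn_applyOn, h1, h2, applyOn_one, pairing_applyOn]

theorem IsUnitary.inv {o : Op l m n q} (h : IsUnitary UA UB o) : IsUnitary UA UB o.inv :=
  ⟨by simpa using h.apply_inv, by simpa using h.inv_apply, by simpa using h.adjoint_inv,
    by simpa using h.adjoint⟩

theorem IsUnitary.invList {L : List (Op l m n q)} (h : ∀ o ∈ L, IsUnitary UA UB o) :
    ∀ o ∈ invList L, IsUnitary UA UB o := by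
  intro o ho
  simp only [Op.invList, List.mem_reverse, List.mem_map] at ho
  obtain ⟨o', h', rfl⟩ := ho
  exact (h o' h').inv

theorem applyList_invList {L : List (Op l m n q)} (h : ∀ o ∈ L, IsUnitary UA UB o)
    (ψ : (Fin q → Bool) → ℂ) : applyList UA UB L (applyList UA UB (invList L) ψ) = ψ := by
  induction L generalizing ψ with
  | nil => rfl
  | cons o L ih =>
    have : Op.invList (o :: L) = Op.invList L ++ [o.inv] := by simp [Op.invList]
    rw [this, applyList_append]
    simp only [applyList_cons, applyList_nil]
    rw [(h o (by simp)).apply_inv, ih fun o' h' => h o' (by simp [h'])]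

theorem pairing_applyList {L : List (Op l m n q)} (h : ∀ o ∈ L, IsUnitary UA UB o)
    (φ ψ : (Fin q → Bool) → ℂ) :
    pairing φ (applyList UA UB L ψ) = pairing (applyList UA UB (invList L) φ) ψ := by
  induction L generalizing ψ with
  | nil => rfl
  | cons o L ih =>
    have : Op.invList (o :: L) = Op.invList L ++ [o.inv] := by simp [Op.invList]
    rw [this, applyList_append]
    simp only [applyList_cons, applyList_nil]
    rw [ih fun o' h' => h o' (by simp [h']), (h o (by simp)).adjoint]

end Op

/-! ### Classical reversible circuits and controlled signs -/

/-- For monomial matrices, such as those of `X`, `T`, `CNOT` and `Toffoli`, the sum over inputs has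
one term. -/
theorem applyOn_of_row {κ : Type} [Fintype κ] [DecidableEq κ] {q : ℕ} (e : κ ↪ Fin q)
    (U : Matrix (κ → Bool) (κ → Bool) ℂ) (ψ : (Fin q → Bool) → ℂ) (x : Fin q → Bool)
    (y₀ : κ → Bool) (c : ℂ) (h : ∀ y, U (fun k => x (e k)) y = if y = y₀ then c else 0) :
    applyOn e U ψ x = c * ψ (Function.extend e y₀ x) := by
  simp [applyOn, h]

/-- A classical reversible gate on `q` bits. -/
inductive BitOp (q : ℕ)
  | x (i : Fin q)
  | cnot (a b : Fin q)
  | toffoli (a b c : Fin q)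

namespace BitOp

variable {l m n q : ℕ}

/-- Add `v` to the bit `i`. -/
def toggle (x : Fin q → Bool) (i : Fin q) (v : Bool) : Fin q → Bool :=
  Function.update x i (xor (x i) v)

/-- The qubits of the gate are distinct. -/
def Valid : BitOp q → Prop
  | .x _ => True
  | .cnot a b => a ≠ b
  | .toffoli a b c => a ≠ b ∧ a ≠ c ∧ b ≠ c

/-- The action on bit strings. -/
def run (x : Fin q → Bool) : BitOp q → (Fin q → Bool)
  | .x i => toggle x i true
  | .cnot a b => toggle x b (x a)
  | .toffoli a b c => toggle x c (x a && x b)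

/-- The action of a list of gates on bit strings, the head of the list first. -/
def runList (x : Fin q → Bool) (L : List (BitOp q)) : Fin q → Bool := L.foldl run x

/-- The embedding that selects a single qubit. -/
def single (i : Fin q) : Fin 1 ↪ Fin q := ⟨fun _ => i, fun _ _ _ => Subsingleton.elim _ _⟩

@[simp] theorem single_apply (i : Fin q) (k : Fin 1) : single i k = i := rfl

open Classical in
/-- The gate as a list of instructions; empty if its qubits are not distinct. -/
def toOps (l m n : ℕ) : BitOp q → List (Op l m n q)
  | .x i => [.gate .X (single i)]
  | .cnot a b => if h : Function.Injective ![a, b] then [.gate .CNOT ⟨![a, b], h⟩] else []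
  | .toffoli a b c =>
      if h : Function.Injective ![a, b, c] then [.gate .Toffoli ⟨![a, b, c], h⟩] else []

/-- A list of gates as a list of instructions. -/
def toOpsList (l m n : ℕ) (L : List (BitOp q)) : List (Op l m n q) := L.flatMap (toOps l m n)

theorem toggle_toggle (x : Fin q → Bool) (i : Fin q) (v : Bool) :
    toggle (toggle x i v) i v = x := by
  simp [toggle]

theorem toggle_of_ne (x : Fin q → Bool) {i j : Fin q} (v : Bool) (h : j ≠ i) :
    toggle x i v j = x j := by
  simp [toggle, h]

theorem run_run {g : BitOp q} (hg : g.Valid) (x : Fin q → Bool) : run (run x g) g = x := by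
  cases g with
  | x i => exact toggle_toggle x i true
  | cnot a b =>
    simp only [run, toggle_of_ne x _ (show a ≠ b from hg), toggle_toggle]
  | toffoli a b c =>
    simp only [run, toggle_of_ne x _ (show a ≠ c from hg.2.1),
      toggle_of_ne x _ (show b ≠ c from hg.2.2), toggle_toggle]

theorem runList_reverse_runList {L : List (BitOp q)} (hL : ∀ g ∈ L, g.Valid) (x : Fin q → Bool) :
    runList (runList x L) L.reverse = x := by
  induction L generalizing x with
  | nil => rfl
  | cons g L ih =>
    have h := ih (fun g' h' => hL g' (by simp [h'])) (run x g)
    simp only [runList, List.foldl_cons, List.reverse_cons, List.foldl_append, List.foldl_nil]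
      at h ⊢
    rw [h, run_run (hL g (by simp))]

variable (UA : PrepUnitaries l m) (UB : PrepUnitaries m n)

theorem extend_eq_update {κ : Type} (e : κ ↪ Fin q) (y : κ → Bool) (x : Fin q → Bool) (k : κ)
    (v : Bool) (h : ∀ k', k' ≠ k → y k' = x (e k')) (hk : y k = v) :
    Function.extend e y x = Function.update x (e k) v := by
  funext i
  by_cases hi : ∃ k, e k = i
  · obtain ⟨k', rfl⟩ := hi
    rw [e.injective.extend_apply]
    by_cases hk' : k' = k
    · subst hk'; simp [hk]
    · rw [Function.update_of_ne (fun hh => hk' (e.injective hh)), h k' hk']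
  · rw [Function.extend_apply' _ _ _ hi, Function.update_of_ne]
    rintro rfl
    exact hi ⟨k, rfl⟩

theorem applyList_toOps {g : BitOp q} (hg : g.Valid) (ψ : (Fin q → Bool) → ℂ)
    (x : Fin q → Bool) : Op.applyList UA UB (toOps l m n g) ψ x = ψ (run x g) := by
  cases g with
  | x i =>
    simp only [toOps, Op.applyList_cons, Op.applyList_nil, Op.apply]
    rw [applyOn_of_row _ _ _ _ (fun _ => !(x i)) 1, one_mul,
      extend_eq_update _ _ _ 0 (!(x i)) (by simp [Subsingleton.elim _ (0 : Fin 1)]) rfl]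
    · simp [run, toggle]
    · intro y
      simp only [Gate.matrix, Matrix.of_apply, funext_iff, Fin.forall_fin_one, single_apply]
      refine if_congr ?_ rfl rfl
      cases x i <;> cases y 0 <;> simp
  | cnot a b =>
    have h : Function.Injective ![a, b] := by
      have : a ≠ b := hg
      intro i j
      fin_cases i <;> fin_cases j <;> simp [this, this.symm]
    simp only [toOps, h, dite_true, Op.applyList_cons, Op.applyList_nil, Op.apply]
    rw [applyOn_of_row _ _ _ _ (![x a, xor (x b) (x a)] : Fin 2 → Bool) 1, one_mul,
      extend_eq_update _ _ _ (1 : Fin 2) (xor (x b) (x a)) (by simp [Fin.forall_fin_two]) rfl]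
    · simp [run, toggle]
    · intro y
      simp only [Gate.matrix, Matrix.of_apply, funext_iff, Fin.forall_fin_two,
        Function.Embedding.coeFn_mk, Matrix.cons_val_zero, Matrix.cons_val_one]
      refine if_congr ?_ rfl rfl
      cases x a <;> cases x b <;> cases y 0 <;> cases y 1 <;> simp
  | toffoli a b c =>
    have h : Function.Injective ![a, b, c] := by
      obtain ⟨h1, h2, h3⟩ := hg
      intro i j
      fin_cases i <;> fin_cases j <;> simp [h1, h2, h3, h1.symm, h2.symm, h3.symm]
    simp only [toOps, h, dite_true, Op.applyList_cons, Op.applyList_nil, Op.apply]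
    rw [applyOn_of_row _ _ _ _ (![x a, x b, xor (x c) (x a && x b)] : Fin 3 → Bool) 1, one_mul,
      extend_eq_update _ _ _ (2 : Fin 3) (xor (x c) (x a && x b))
        (by simp [Fin.forall_fin_succ]) rfl]
    · simp [run, toggle]
    · intro y
      simp only [Gate.matrix, Matrix.of_apply, funext_iff, Fin.forall_fin_succ,
        Function.Embedding.coeFn_mk]
      simp only [Matrix.cons_val_zero, Matrix.cons_val_succ, Fin.succ_zero_eq_one,
        Fin.succ_one_eq_two, IsEmpty.forall_iff, and_true, Matrix.cons_val_one, Matrix.cons_val]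
      refine if_congr ?_ rfl rfl
      cases x a <;> cases x b <;> cases x c <;> cases y 0 <;> cases y 1 <;> cases y 2 <;> simp

/-- A permutation of basis states acts on amplitudes by pulling back along its inverse. The gates
are involutions, so the inverse is the reversed list. -/
theorem applyList_toOpsList {L : List (BitOp q)} (hL : ∀ g ∈ L, g.Valid)
    (ψ : (Fin q → Bool) → ℂ) (x : Fin q → Bool) :
    Op.applyList UA UB (toOpsList l m n L) ψ x = ψ (runList x L.reverse) := by
  induction L generalizing ψ with
  | nil => rfl
  | cons g L ih =>
    have : toOpsList l m n (g :: L) = toOps l m n g ++ toOpsList l m n L := rfl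
    rw [this, Op.applyList_append, ih fun g' h' => hL g' (by simp [h']),
      applyList_toOps UA UB (hL g (by simp))]
    simp [runList]

/-- Flip the sign of the states whose bit `a` is set. -/
def zOps (l m n : ℕ) (a : Fin q) : List (Op l m n q) :=
  List.replicate 4 (.gate .T (single a))

theorem applyList_zOps (a : Fin q) (ψ : (Fin q → Bool) → ℂ) (x : Fin q → Bool) :
    Op.applyList UA UB (zOps l m n a) ψ x = (if x a then -1 else 1) * ψ x := by
  have h : ∀ φ : (Fin q → Bool) → ℂ, (Op.gate .T (single a) : Op l m n q).apply UA UB φ =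
      fun x => (if x a then Complex.exp (Complex.I * Real.pi / 4) else 1) * φ x := by
    intro φ
    funext x
    rw [Op.apply, applyOn_of_row _ _ _ _ (fun k => x (single a k))
      (if x a then Complex.exp (Complex.I * Real.pi / 4) else 1), extend_self]
    intro y
    simp only [Gate.matrix, Matrix.of_apply, funext_iff, Fin.forall_fin_one, single_apply,
      eq_comm (a := y 0)]
  -- Four `T` gates make a `Z` gate.
  have h4 : Complex.exp (Complex.I * Real.pi / 4) ^ 4 = -1 := by
    rw [← Complex.exp_nat_mul, ← Complex.exp_pi_mul_I]
    congr 1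
    push_cast
    ring
  simp only [zOps, List.replicate, Op.applyList_cons, Op.applyList_nil, h]
  cases x a
  · simp
  · simp only [if_true, ← mul_assoc]
    rw [← h4]
    ring

/-- The circuit that adds to the last ancilla of the list whether the bit `c` is set and all
qubits of the list are zero. Each entry consists of a qubit and an ancilla of its own. -/
def ladder : Fin q → List (Fin q × Fin q) → List (BitOp q)
  | _, [] => []
  | c, (i, c') :: r => .x i :: .toffoli i c c' :: .x i :: ladder c' r

/-- The ancilla that holds the result of `ladder`. -/
def ladderOut : Fin q → List (Fin q × Fin q) → Fin q
  | c, [] => c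
  | _, (_, c') :: r => ladderOut c' r

/-- The ancillas are distinct from each other and from the qubits. -/
def LadderValid (c : Fin q) (r : List (Fin q × Fin q)) : Prop :=
  (c :: r.map Prod.snd).Nodup ∧ ∀ i ∈ r.map Prod.fst, i ∉ c :: r.map Prod.snd

theorem LadderValid.tail {c i c' : Fin q} {r : List (Fin q × Fin q)}
    (h : LadderValid c ((i, c') :: r)) : LadderValid c' r := by
  refine ⟨(List.nodup_cons.1 h.1).2, fun j hj hj' => ?_⟩
  exact h.2 j (List.mem_cons_of_mem _ hj) (List.mem_cons_of_mem _ hj')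

theorem ladder_valid {c : Fin q} {r : List (Fin q × Fin q)} (h : LadderValid c r) :
    ∀ g ∈ ladder c r, g.Valid := by
  induction r generalizing c with
  | nil => simp [ladder]
  | cons p r ih =>
    obtain ⟨i, c'⟩ := p
    have h1 := h.1
    have h2 := h.2 i (by simp)
    simp only [List.map_cons, List.nodup_cons, List.mem_cons, not_or] at h1 h2
    intro g hg
    simp only [ladder, List.mem_cons] at hg
    rcases hg with rfl | rfl | rfl | hg
    · trivial
    · exact ⟨h2.1, h2.2.1, h1.1.1⟩
    · trivial
    · exact ih h.tail g hg

/-- Each rung conjugates a Toffoli by `X`, so it writes `x c && !x i` into the fresh ancilla `c'`,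
which then serves as control for the next rung. Zero ancillas turn the addition into an assignment.
-/
theorem runList_ladder {c : Fin q} {r : List (Fin q × Fin q)} (h : LadderValid c r)
    (x : Fin q → Bool) (hx : ∀ c' ∈ r.map Prod.snd, x c' = false) :
    runList x (ladder c r) (ladderOut c r) = (x c && decide (∀ i ∈ r.map Prod.fst, x i = false)) := by
  induction r generalizing c x with
  | nil => simp [ladder, ladderOut, runList]
  | cons p r ih =>
    obtain ⟨i, c'⟩ := p
    have h1 := h.1
    have h2 := h.2 i (by simp)
    simp only [List.map_cons, List.nodup_cons, List.mem_cons, not_or] at h1 h2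
    have hc' : x c' = false := hx c' (by simp)
    have key : run (run (run x (.x i)) (.toffoli i c c')) (.x i) =
        Function.update x c' (x c && !x i) := by
      funext j
      simp only [run, toggle]
      by_cases hj : j = i
      · subst hj
        simp [h2.2.1, Ne.symm h2.1]
      · by_cases hj' : j = c'
        · subst hj'
          simp [hj, Ne.symm h2.1, hc', Bool.and_comm]
        · simp [hj, hj']
    have e1 : runList x (ladder c ((i, c') :: r)) =
        runList (Function.update x c' (x c && !x i)) (ladder c' r) := by
      rw [← key]; rfl
    rw [e1, show ladderOut c ((i, c') :: r) = ladderOut c' r from rfl, ih h.tail]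
    · have : (∀ j ∈ r.map Prod.fst, Function.update x c' (x c && !x i) j = false) ↔
          ∀ j ∈ r.map Prod.fst, x j = false := by
        refine forall₂_congr fun j hj => ?_
        rw [Function.update_of_ne]
        rintro rfl
        exact h.2 j (List.mem_cons_of_mem _ hj) (by simp)
      rw [Function.update_self, Bool.eq_iff_iff]
      simp only [Bool.and_eq_true, Bool.not_eq_true', decide_eq_true_eq, this, List.map_cons,
        List.forall_mem_cons, and_assoc]
    · intro d hd
      rw [Function.update_of_ne]
      · exact hx d (List.mem_cons_of_mem _ hd)
      · rintro rfl
        exact h1.2.1 hd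

/-- Flip the sign of the states in which all qubits of the list `r` are zero. -/
def signOps (l m n : ℕ) (c : Fin q) (r : List (Fin q × Fin q)) : List (Op l m n q) :=
  toOpsList l m n (.x c :: ladder c r) ++ zOps l m n (ladderOut c r) ++
    toOpsList l m n (.x c :: ladder c r).reverse

/-- Compute the conjunction, apply `Z` to it, uncompute. The leading `X` sets the first control to
one. Basis states with a set ancilla have amplitude zero, so the ladder's value there is irrelevant.
-/
theorem applyList_signOps {c : Fin q} {r : List (Fin q × Fin q)} (h : LadderValid c r)
    (ψ : (Fin q → Bool) → ℂ) (hψ : ∀ a ∈ c :: r.map Prod.snd, ∀ x, x a = true → ψ x = 0) :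
    Op.applyList UA UB (signOps l m n c r) ψ =
      fun x => if ∀ i ∈ r.map Prod.fst, x i = false then -ψ x else ψ x := by
  have hv : ∀ g ∈ (BitOp.x c :: ladder c r), g.Valid := by
    intro g hg
    rcases List.mem_cons.1 hg with rfl | hg
    · trivial
    · exact ladder_valid h g hg
  funext x
  simp only [signOps, Op.applyList_append]
  rw [applyList_toOpsList UA UB (fun g hg => hv g (List.mem_reverse.1 hg)), List.reverse_reverse,
    applyList_zOps, applyList_toOpsList UA UB hv, runList_reverse_runList hv]
  by_cases hx : ∃ a ∈ c :: r.map Prod.snd, x a = true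
  · obtain ⟨a, ha, hxa⟩ := hx
    simp [hψ a ha x hxa]
  · push Not at hx
    have hx' : ∀ a ∈ c :: r.map Prod.snd, x a = false := fun a ha => by simpa using hx a ha
    have hne : ∀ j, j ≠ c → run x (.x c) j = x j := fun j hj => toggle_of_ne x _ hj
    have hnd := List.nodup_cons.1 h.1
    rw [show runList x (BitOp.x c :: ladder c r) = runList (run x (.x c)) (ladder c r) from rfl,
      runList_ladder h]
    · have : (∀ j ∈ r.map Prod.fst, run x (.x c) j = false) ↔
          ∀ j ∈ r.map Prod.fst, x j = false := by
        refine forall₂_congr fun j hj => ?_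
        rw [hne]
        rintro rfl
        exact h.2 j hj (by simp)
      have hc : run x (.x c) c = true := by simp [run, toggle, hx' c (by simp)]
      simp only [hc, Bool.true_and, decide_eq_true_eq, this]
      split_ifs <;> simp
    · intro d hd
      rw [hne]
      · exact hx' d (List.mem_cons_of_mem _ hd)
      · rintro rfl
        exact hnd.1 hd

theorem costList_toOpsList_le (τ : ℝ) (L : List (BitOp q)) :
    Op.costList τ (toOpsList l m n L) ≤ L.length := by
  induction L with
  | nil => simp [toOpsList]
  | cons g L ih =>
    have : toOpsList l m n (g :: L) = toOps l m n g ++ toOpsList l m n L := rfl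
    have hg : Op.costList τ (toOps l m n g) ≤ 1 := by
      cases g <;> simp only [toOps] <;> (try split_ifs) <;> simp [Op.cost]
    rw [this, Op.costList_append, List.length_cons]
    push_cast
    linarith

theorem length_ladder (c : Fin q) (r : List (Fin q × Fin q)) :
    (ladder c r).length = 3 * r.length := by
  induction r generalizing c with
  | nil => rfl
  | cons p r ih => simp [ladder, ih]; ring

theorem costList_signOps_le (τ : ℝ) (c : Fin q) (r : List (Fin q × Fin q)) :
    Op.costList τ (signOps l m n c r) ≤ 6 * (r.length + 1) := by
  have h1 := costList_toOpsList_le (l := l) (m := m) (n := n) τ (.x c :: ladder c r)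
  have h2 := costList_toOpsList_le (l := l) (m := m) (n := n) τ (.x c :: ladder c r).reverse
  have h3 : Op.costList τ (zOps l m n (ladderOut c r)) = 4 := by
    simp [zOps, List.replicate, Op.cost]; norm_num
  simp only [List.length_reverse, List.length_cons, length_ladder] at h1 h2
  push_cast at h1 h2
  simp only [signOps, Op.costList_append]
  linarith

/-- `CNOT` is the only gate in `mulOps`, the only circuit that is inverted through `Op.invList`;
hence the convention in `Op.inv` that gates are self-inverse does no harm to `T`. -/
theorem isUnitary_cnot {a b : Fin q} (hab : a ≠ b) :
    ∀ o ∈ toOps l m n (.cnot a b), Op.IsUnitary UA UB o := by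
  have h := fun ψ => funext (applyList_toOps UA UB (g := .cnot a b) hab ψ)
  have hr : Function.Involutive (fun x => run x (.cnot a b)) :=
    fun x => run_run (g := .cnot a b) hab x
  intro o ho
  simp only [toOps] at h ho
  split_ifs at h ho with hi
  · rw [List.mem_singleton] at ho
    subst ho
    simp only [Op.applyList_cons, Op.applyList_nil] at h
    have h1 : ∀ ψ, (Op.gate .CNOT ⟨![a, b], hi⟩ : Op l m n q).apply UA UB
        ((Op.gate .CNOT ⟨![a, b], hi⟩ : Op l m n q).apply UA UB ψ) = ψ := by
      intro ψ
      rw [h, h]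
      funext x
      exact congrArg ψ (hr x)
    have h2 : ∀ φ ψ, pairing φ ((Op.gate .CNOT ⟨![a, b], hi⟩ : Op l m n q).apply UA UB ψ) =
        pairing ((Op.gate .CNOT ⟨![a, b], hi⟩ : Op l m n q).apply UA UB φ) ψ := by
      intro φ ψ
      rw [h, h]
      refine Fintype.sum_equiv hr.toPerm _ _ fun x => ?_
      simp [run_run (g := .cnot a b) hab]
    exact ⟨h1, h1, h2, h2⟩
  · simp at ho

end BitOp

/-! ### Executions of programs -/

namespace Program

variable {l m n : ℕ} (P : Program l m n) (UA : PrepUnitaries l m) (UB : PrepUnitaries m n) (τ : ℝ)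

/-- The branches that arise from `c` after `N` steps. -/
def after : ℕ → Config P.qubits P.Loc → List (Config P.qubits P.Loc)
  | 0, c => [c]
  | N + 1, c => (P.succs UA UB τ c).flatMap (after N)

/-- `branches` adds steps at the end and `after` at the beginning; the weight estimates recurse on
the first step. -/
theorem after_succ' (N : ℕ) (c : Config P.qubits P.Loc) :
    P.after UA UB τ (N + 1) c = (P.after UA UB τ N c).flatMap (P.succs UA UB τ) := by
  induction N generalizing c with
  | zero => simp [after]
  | succ N ih =>
    rw [after, List.flatMap_congr fun c' _ => ih c', ← List.flatMap_assoc]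
    rfl

theorem branches_eq_after (N : ℕ) :
    P.branches UA UB τ N = P.after UA UB τ N ⟨P.start, ket (fun _ => false), 0⟩ := by
  induction N with
  | zero => rfl
  | succ N ih => rw [after_succ', ← ih]; rfl

theorem branches_invariant (I : Config P.qubits P.Loc → Prop)
    (h0 : I ⟨P.start, ket (fun _ => false), 0⟩)
    (hs : ∀ c, I c → ∀ c' ∈ P.succs UA UB τ c, I c') (N : ℕ) :
    ∀ c ∈ P.branches UA UB τ N, I c := by
  induction N with
  | zero => simpa [branches] using h0
  | succ N ih =>
    intro c hc
    obtain ⟨c', h', hc'⟩ := List.mem_flatMap.1 hc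
    exact hs c' (ih c' h') c hc'

open Classical in
/-- The probability weight of a list of branches that have halted by time `T`. -/
def haltWeight (T : ℝ) (L : List (Config P.qubits P.Loc)) : ℝ :=
  (L.map (fun c => if P.Halted c ∧ c.time ≤ T then l2norm c.state ^ 2 else 0)).sum

theorem haltWeight_nonneg (T : ℝ) (L : List (Config P.qubits P.Loc)) : 0 ≤ P.haltWeight T L := by
  refine List.sum_nonneg fun a ha => ?_
  obtain ⟨c, -, rfl⟩ := List.mem_map.1 ha
  split_ifs <;> positivity

theorem haltWeight_append (T : ℝ) (L M : List (Config P.qubits P.Loc)) :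
    P.haltWeight T (L ++ M) = P.haltWeight T L + P.haltWeight T M := by
  simp [haltWeight]

/-- From the branch `c`, the weight `p` has halted by time `T`, after sufficiently many steps. -/
def HaltsBy (c : Config P.qubits P.Loc) (p T : ℝ) : Prop :=
  ∃ N₀, ∀ N, N₀ ≤ N → p ≤ P.haltWeight T (P.after UA UB τ N c)

variable {P UA UB τ}

theorem HaltsBy.of_nonpos {c : Config P.qubits P.Loc} {p T : ℝ} (hp : p ≤ 0) :
    P.HaltsBy UA UB τ c p T :=
  ⟨0, fun _ _ => hp.trans (P.haltWeight_nonneg _ _)⟩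

theorem HaltsBy.mono {c : Config P.qubits P.Loc} {p p' T : ℝ} (h : P.HaltsBy UA UB τ c p T)
    (hp : p' ≤ p) : P.HaltsBy UA UB τ c p' T := by
  obtain ⟨N₀, h⟩ := h
  exact ⟨N₀, fun N hN => hp.trans (h N hN)⟩

theorem HaltsBy.of_halted {c : Config P.qubits P.Loc} {T : ℝ} (hc : P.instr c.loc = .halt)
    (hT : c.time ≤ T) : P.HaltsBy UA UB τ c (l2norm c.state ^ 2) T := by
  have h : ∀ N, P.after UA UB τ N c = [c] := by
    intro N
    induction N with
    | zero => rfl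
    | succ N ih => simp [after, succs, hc, ih]
  refine ⟨0, fun N _ => ?_⟩
  simp [h, haltWeight, Halted, hc, hT]

theorem HaltsBy.of_succs_singleton {c c' : Config P.qubits P.Loc} {p T : ℝ}
    (h : P.HaltsBy UA UB τ c' p T) (hc : P.succs UA UB τ c = [c']) :
    P.HaltsBy UA UB τ c p T := by
  obtain ⟨N₀, h⟩ := h
  refine ⟨N₀ + 1, fun N hN => ?_⟩
  obtain ⟨N, rfl⟩ : ∃ N', N = N' + 1 := ⟨N - 1, by omega⟩
  simpa [after, hc] using h N (by omega)

theorem HaltsBy.of_succs_pair {c c₁ c₂ : Config P.qubits P.Loc} {p₁ p₂ T : ℝ}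
    (h₁ : P.HaltsBy UA UB τ c₁ p₁ T) (h₂ : P.HaltsBy UA UB τ c₂ p₂ T)
    (hc : P.succs UA UB τ c = [c₁, c₂]) : P.HaltsBy UA UB τ c (p₁ + p₂) T := by
  obtain ⟨N₁, h₁⟩ := h₁
  obtain ⟨N₂, h₂⟩ := h₂
  -- Branches may halt after different numbers of steps; since `HaltsBy` bounds the weight for all
  -- large `N`, the larger threshold serves both.
  refine ⟨max N₁ N₂ + 1, fun N hN => ?_⟩
  obtain ⟨N, rfl⟩ : ∃ N', N = N' + 1 := ⟨N - 1, by omega⟩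
  simp only [after, hc, List.flatMap_cons, List.flatMap_nil, List.append_nil, haltWeight_append]
  exact add_le_add (h₁ N (by omega)) (h₂ N (by omega))

end Program

/-! ### Programs that repeat attempts until one succeeds -/

/-- A step of an attempt: a unitary instruction, a measurement after which the attempt has failed
if the outcome is one, or the reset of a qubit. -/
inductive Cmd (l m n q : ℕ)
  | op (o : Op l m n q)
  | test (i : Fin q)
  | reset (i : Fin q)

section Repeat

variable {l m n q : ℕ} (att : ℕ → List (Cmd l m n q))

/-- Reset all qubits. -/
def resetAll (l m n q : ℕ) : List (Cmd l m n q) := (List.finRange q).map .reset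

/-- The instruction at a location, which consists of the index of the attempt and the steps that
remain. -/
def repeatInstr : ℕ × List (Cmd l m n q) → Instr l m n q (ℕ × List (Cmd l m n q))
  | (_, []) => .halt
  | (s, .op (.gate g e) :: r) => .gate g e (s, r)
  | (s, .op (.prepA p b e) :: r) => .prepA p b e (s, r)
  | (s, .op (.prepB p b e) :: r) => .prepB p b e (s, r)
  | (s, .test i :: r) =>
      .measure i fun b => if b then (s + 1, resetAll l m n q ++ att (s + 1)) else (s, r)
  | (s, .reset i :: r) =>
      .measure i fun b => if b then (s, .op (.gate .X (BitOp.single i)) :: r) else (s, r)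

/-- The program that makes the attempts `att 0`, `att 1`, … until one succeeds. -/
def repeatProgram (out : Reg l n ↪ Fin q) : Program l m n where
  qubits := q
  Loc := ℕ × List (Cmd l m n q)
  start := (0, att 0)
  instr := repeatInstr att
  out := out

/-- The part of the state in which the qubit `i` has the value `b`. -/
def proj (i : Fin q) (b : Bool) (ψ : (Fin q → Bool) → ℂ) : (Fin q → Bool) → ℂ :=
  fun x => if x i = b then ψ x else 0

theorem l2norm_proj_add (i : Fin q) (ψ : (Fin q → Bool) → ℂ) :
    l2norm (proj i false ψ) ^ 2 + l2norm (proj i true ψ) ^ 2 = l2norm ψ ^ 2 := by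
  rw [l2norm_sq, l2norm_sq, l2norm_sq, ← Finset.sum_add_distrib]
  refine Finset.sum_congr rfl fun x _ => ?_
  cases h : x i <;> simp [proj, h]

/-- The part of the state in which all qubits of the list `L` are zero. -/
def projList (L : List (Fin q)) (ψ : (Fin q → Bool) → ℂ) : (Fin q → Bool) → ℂ :=
  fun x => if ∀ i ∈ L, x i = false then ψ x else 0

theorem projList_nil (ψ : (Fin q → Bool) → ℂ) : projList [] ψ = ψ := by
  funext x
  simp [projList]

theorem projList_cons (i : Fin q) (L : List (Fin q)) (ψ : (Fin q → Bool) → ℂ) :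
    projList (i :: L) ψ = projList L (proj i false ψ) := by
  funext x
  simp only [projList, proj, List.forall_mem_cons]
  split_ifs <;> simp_all

variable (UA : PrepUnitaries l m) (UB : PrepUnitaries m n)

/-- The state after applying the gate `X` to the qubit `i`. -/
def flipQubit (i : Fin q) (ψ : (Fin q → Bool) → ℂ) : (Fin q → Bool) → ℂ :=
  fun x => ψ (BitOp.toggle x i true)

theorem apply_X (i : Fin q) (ψ : (Fin q → Bool) → ℂ) :
    (Op.gate .X (BitOp.single i) : Op l m n q).apply UA UB ψ = flipQubit i ψ :=
  funext fun x => BitOp.applyList_toOps UA UB (g := .x i) trivial ψ x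

theorem l2norm_flipQubit (i : Fin q) (ψ : (Fin q → Bool) → ℂ) :
    l2norm (flipQubit i ψ) ^ 2 = l2norm ψ ^ 2 := by
  rw [l2norm_sq, l2norm_sq]
  exact Fintype.sum_equiv
    (Function.Involutive.toPerm _ fun x => BitOp.toggle_toggle x i true) _ _ fun x => rfl

/-- All qubits outside the list `L` are zero. -/
def ZeroOutside (L : List (Fin q)) (ψ : (Fin q → Bool) → ℂ) : Prop :=
  ∀ i ∉ L, ∀ x, x i = true → ψ x = 0

theorem ZeroOutside.proj {i : Fin q} {L : List (Fin q)} {ψ : (Fin q → Bool) → ℂ}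
    (h : ZeroOutside (i :: L) ψ) : ZeroOutside L (proj i false ψ) := by
  intro j hj x hx
  by_cases hji : j = i
  · subst hji; simp [QMatMul.proj, hx]
  · simp [QMatMul.proj, h j (by simp [hji, hj]) x hx]

theorem ZeroOutside.flip_proj {i : Fin q} {L : List (Fin q)} {ψ : (Fin q → Bool) → ℂ}
    (h : ZeroOutside (i :: L) ψ) : ZeroOutside L (flipQubit i (QMatMul.proj i true ψ)) := by
  intro j hj x hx
  by_cases hji : j = i
  · subst hji; simp [QMatMul.proj, flipQubit, BitOp.toggle, hx]
  · have : ψ (BitOp.toggle x i true) = 0 :=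
      h j (by simp [hji, hj]) _ (by rw [BitOp.toggle_of_ne _ _ hji, hx])
    simp [QMatMul.proj, flipQubit, this]

theorem ZeroOutside.eq_smul_ket {ψ : (Fin q → Bool) → ℂ} (h : ZeroOutside [] ψ) :
    ψ = ψ (fun _ => false) • ket (fun _ => false) := by
  funext x
  by_cases hx : x = fun _ => false
  · simp [hx, ket]
  · obtain ⟨i, hi⟩ := Function.ne_iff.1 hx
    rw [h i (by simp) x (by simpa using hi)]
    simp [ket, hx]

/-- The state `ψ` satisfies `Q` whenever the remaining steps `L` of an attempt succeed. -/
def Ensures (Q : ((Fin q → Bool) → ℂ) → Prop) : List (Cmd l m n q) → ((Fin q → Bool) → ℂ) → Prop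
  | [], ψ => Q ψ
  | .op o :: L, ψ => Ensures Q L (o.apply UA UB ψ)
  | .test i :: L, ψ => Ensures Q L (proj i false ψ)
  | .reset i :: L, ψ => Ensures Q L (proj i false ψ) ∧ Ensures Q L (flipQubit i (proj i true ψ))

variable {UA UB att}

theorem ensures_ops {Q : ((Fin q → Bool) → ℂ) → Prop} (O : List (Op l m n q))
    (L : List (Cmd l m n q)) (ψ : (Fin q → Bool) → ℂ) :
    Ensures UA UB Q (O.map .op ++ L) ψ ↔ Ensures UA UB Q L (Op.applyList UA UB O ψ) := by
  induction O generalizing ψ with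
  | nil => rfl
  | cons o O ih => exact ih _

theorem ensures_tests {Q : ((Fin q → Bool) → ℂ) → Prop} (S : List (Fin q))
    (ψ : (Fin q → Bool) → ℂ) :
    Ensures UA UB Q (S.map .test) ψ ↔ Q (projList S ψ) := by
  induction S generalizing ψ with
  | nil => rw [projList_nil]; rfl
  | cons i S ih => rw [projList_cons]; exact ih _

/-- In either outcome of a reset the qubit ends at zero, so once `S` is exhausted only a multiple of
`|0…0⟩` remains. The scalar is arbitrary because branches are unnormalised. -/
theorem ensures_resets {Q : ((Fin q → Bool) → ℂ) → Prop} {L : List (Cmd l m n q)}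
    (h : ∀ z : ℂ, Ensures UA UB Q L (z • ket fun _ => false)) (S : List (Fin q))
    {ψ : (Fin q → Bool) → ℂ} (hψ : ZeroOutside S ψ) :
    Ensures UA UB Q (S.map .reset ++ L) ψ := by
  induction S generalizing ψ with
  | nil => rw [hψ.eq_smul_ket]; exact h _
  | cons i S ih => exact ⟨ih hψ.proj, ih hψ.flip_proj⟩

/-- `Ensures` for the remaining steps is an invariant of every branch, and at an empty list of steps
it is `Q` itself. -/
theorem repeatProgram_halted {Q : ((Fin q → Bool) → ℂ) → Prop} {out : Reg l n ↪ Fin q}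
    (h : ∀ s (z : ℂ), Ensures UA UB Q (att s) (z • ket fun _ => false)) (τ : ℝ) (N : ℕ) :
    ∀ c ∈ (repeatProgram att out).branches UA UB τ N, (repeatProgram att out).Halted c →
      Q c.state := by
  have key := (repeatProgram att out).branches_invariant UA UB τ
    (fun c => Ensures UA UB Q c.loc.2 c.state) (by have := h 0 1; rwa [one_smul] at this) ?_ N
  · rintro ⟨⟨s, L⟩, ψ, t⟩ hc hH
    have hk := key _ hc
    rcases L with - | ⟨⟨⟨⟩⟩ | ⟨⟩ | ⟨⟩, L⟩ <;>
      first
      | exact hk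
      | simp [Program.Halted, repeatProgram, repeatInstr] at hH
  · rintro ⟨⟨s, L⟩, ψ, t⟩ hI c' hc'
    rcases L with - | ⟨⟨o | o | o⟩ | i | i, L⟩
    · obtain rfl := List.mem_singleton.1 hc'
      exact hI
    · obtain rfl := List.mem_singleton.1 hc'
      exact hI
    · obtain rfl := List.mem_singleton.1 hc'
      exact hI
    · obtain rfl := List.mem_singleton.1 hc'
      exact hI
    · rcases List.mem_pair.1 hc' with rfl | rfl
      · exact hI
      -- After a failed test nothing is known about the state, but `resetAll` covers every qubit.
      · exact ensures_resets (h (s + 1)) _ fun i hi => absurd (List.mem_finRange i) hi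
    · rcases List.mem_pair.1 hc' with rfl | rfl
      · exact hI.1
      · show Ensures UA UB Q (.op (.gate .X (BitOp.single i)) :: L) (proj i true ψ)
        rw [Ensures, apply_X]
        exact hI.2

/-! ### Halting probability and elapsed time of repeated attempts. -/

section Weights

variable {out : Reg l n ↪ Fin q} {τ : ℝ}

variable (att out UA UB τ) in
/-- Attempt `s` of the program, when the steps `L` remain, has halted with weight `p` by time `T`
if it is in the state `ψ` at time `t`. -/
def RepeatHaltsBy (s : ℕ) (L : List (Cmd l m n q)) (ψ : (Fin q → Bool) → ℂ) (t p T : ℝ) : Prop :=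
  (repeatProgram att out).HaltsBy UA UB τ ⟨(s, L), ψ, t⟩ p T

theorem RepeatHaltsBy.mono {s : ℕ} {L : List (Cmd l m n q)} {ψ : (Fin q → Bool) → ℂ}
    {t p p' T : ℝ} (h : RepeatHaltsBy att UA UB out τ s L ψ t p T) (hp : p' ≤ p) :
    RepeatHaltsBy att UA UB out τ s L ψ t p' T :=
  Program.HaltsBy.mono h hp

theorem RepeatHaltsBy.op {s : ℕ} {L : List (Cmd l m n q)} {ψ : (Fin q → Bool) → ℂ}
    {t p T : ℝ} {o : Op l m n q}
    (h : RepeatHaltsBy att UA UB out τ s L (o.apply UA UB ψ) (t + o.cost τ) p T) :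
    RepeatHaltsBy att UA UB out τ s (.op o :: L) ψ t p T :=
  Program.HaltsBy.of_succs_singleton h (by cases o <;> rfl)

theorem RepeatHaltsBy.test {s : ℕ} {L : List (Cmd l m n q)} {ψ : (Fin q → Bool) → ℂ}
    {t p₁ p₂ T : ℝ} {i : Fin q}
    (h₁ : RepeatHaltsBy att UA UB out τ s L (proj i false ψ) (t + 1) p₁ T)
    (h₂ : RepeatHaltsBy att UA UB out τ (s + 1) (resetAll l m n q ++ att (s + 1))
      (proj i true ψ) (t + 1) p₂ T) :
    RepeatHaltsBy att UA UB out τ s (.test i :: L) ψ t (p₁ + p₂) T :=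
  Program.HaltsBy.of_succs_pair h₁ h₂ rfl

theorem RepeatHaltsBy.reset {s : ℕ} {L : List (Cmd l m n q)} {ψ : (Fin q → Bool) → ℂ}
    {t p₁ p₂ T : ℝ} {i : Fin q}
    (h₁ : RepeatHaltsBy att UA UB out τ s L (proj i false ψ) (t + 1) p₁ T)
    (h₂ : RepeatHaltsBy att UA UB out τ s L (flipQubit i (proj i true ψ)) (t + 1 + 1) p₂ T) :
    RepeatHaltsBy att UA UB out τ s (.reset i :: L) ψ t (p₁ + p₂) T := by
  have h₃ : RepeatHaltsBy att UA UB out τ s (.op (.gate .X (BitOp.single i)) :: L)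
      (proj i true ψ) (t + 1) p₂ T := .op (by rw [apply_X]; exact h₂)
  exact Program.HaltsBy.of_succs_pair h₁ h₃ rfl

theorem RepeatHaltsBy.halt {s : ℕ} {ψ : (Fin q → Bool) → ℂ} {t T : ℝ} (h : t ≤ T) :
    RepeatHaltsBy att UA UB out τ s [] ψ t (l2norm ψ ^ 2) T :=
  Program.HaltsBy.of_halted rfl h

theorem haltsBy_ops (O : List (Op l m n q)) {s : ℕ} {L : List (Cmd l m n q)}
    {ψ : (Fin q → Bool) → ℂ} {t p T : ℝ}
    (h : RepeatHaltsBy att UA UB out τ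
      s L (Op.applyList UA UB O ψ) (t + Op.costList τ O) p T) :
    RepeatHaltsBy att UA UB out τ s (O.map .op ++ L) ψ t p T := by
  induction O generalizing ψ t with
  | nil => simpa using h
  | cons o O ih =>
    rw [Op.costList_cons, ← add_assoc] at h
    exact (ih h).op

/-- The bound assumed for the continuation is proportional to the squared norm, which the two
outcomes of each reset share out without loss. A reset costs at most two units: a measurement and
possibly an `X`. -/
theorem haltsBy_resets {s : ℕ} {L : List (Cmd l m n q)} {p t₁ T : ℝ} (S : List (Fin q))
    (h : ∀ (z : ℂ) (t : ℝ), t ≤ t₁ → RepeatHaltsBy att UA UB out τ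
      s L (z • ket fun _ => false) t (‖z‖ ^ 2 * p) T)
    {ψ : (Fin q → Bool) → ℂ} (hψ : ZeroOutside S ψ) {t : ℝ} (ht : t + 2 * S.length ≤ t₁) :
    RepeatHaltsBy att UA UB out τ s (S.map .reset ++ L) ψ t
      (l2norm ψ ^ 2 * p) T := by
  induction S generalizing ψ t with
  | nil =>
    have h' := h (ψ fun _ => false) t (by simpa using ht)
    have hn : l2norm ψ = ‖ψ fun _ => false‖ := by
      conv_lhs => rw [hψ.eq_smul_ket]
      rw [l2norm_smul, l2norm_ket, mul_one]
    rw [hn, hψ.eq_smul_ket]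
    simpa [ket] using h'
  | cons i S ih =>
    rw [List.length_cons] at ht
    push_cast at ht
    have h1 := ih hψ.proj (t := t + 1) (by linarith)
    have h2 := ih hψ.flip_proj (t := t + 1 + 1) (by linarith)
    refine (h1.reset h2).mono ?_
    rw [l2norm_flipQubit, ← l2norm_proj_add i ψ]
    linarith

/-- The weight that passes all tests halts at once; the complementary weight, wherever it fails, is
reset and halts with conditional probability `p`. The time budget covers all tests and the reset of
`q` qubits. -/
theorem haltsBy_tests {s : ℕ} {p t₁ T : ℝ} (S : List (Fin q)) (hT : t₁ ≤ T)
    (h : ∀ (z : ℂ) (t : ℝ), t ≤ t₁ → RepeatHaltsBy att UA UB out τ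
      (s + 1) (att (s + 1)) (z • ket fun _ => false) t (‖z‖ ^ 2 * p) T)
    {ψ : (Fin q → Bool) → ℂ} {t : ℝ} (ht : t + S.length + 2 * q ≤ t₁) :
    RepeatHaltsBy att UA UB out τ s (S.map .test) ψ t
      (l2norm (projList S ψ) ^ 2 + (l2norm ψ ^ 2 - l2norm (projList S ψ) ^ 2) * p) T := by
  induction S generalizing ψ t with
  | nil =>
    rw [projList_nil, sub_self, zero_mul, add_zero]
    have hq : (0 : ℝ) ≤ q := by positivity
    exact .halt (by simp only [List.length_nil, Nat.cast_zero] at ht; linarith)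
  | cons i S ih =>
    rw [List.length_cons] at ht
    push_cast at ht
    have hS : (0 : ℝ) ≤ S.length := by positivity
    have h1 := ih (ψ := proj i false ψ) (t := t + 1) (by linarith)
    have h2 := haltsBy_resets (s := s + 1) (L := att (s + 1)) (List.finRange q) h
      (ψ := proj i true ψ) (t := t + 1) (fun i hi => absurd (List.mem_finRange i) hi)
      (by rw [List.length_finRange]; linarith)
    refine (h1.test h2).mono ?_
    rw [projList_cons, ← l2norm_proj_add i ψ]
    linarith

/-- If the attempt `s` takes time `cost s` and prepares a unit vector whose tests succeed with
probability `w s`, then the first `k` attempts fail with probability at most `∏ (1 - w s)`. -/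
theorem haltsBy_attempts {O : ℕ → List (Op l m n q)} {S : List (Fin q)}
    (hatt : ∀ s, att s = (O s).map .op ++ S.map .test) {w cost : ℕ → ℝ}
    (hnorm : ∀ s, l2norm (Op.applyList UA UB (O s) (ket fun _ => false)) = 1)
    (hw : ∀ s, l2norm (projList S (Op.applyList UA UB (O s) (ket fun _ => false))) ^ 2 = w s)
    (hcost₀ : ∀ s, 0 ≤ cost s) (hcost : ∀ s, Op.costList τ (O s) + S.length + 2 * q ≤ cost s)
    (k s : ℕ) (z : ℂ) (t T : ℝ)
    (hT : t + ∑ i ∈ Finset.range k, cost (s + i) ≤ T) :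
    RepeatHaltsBy att UA UB out τ s (att s) (z • ket fun _ => false) t
      (‖z‖ ^ 2 * (1 - ∏ i ∈ Finset.range k, (1 - w (s + i)))) T := by
  induction k generalizing s z t T with
  | zero => exact Program.HaltsBy.of_nonpos (by simp)
  | succ k ih =>
    rw [Finset.sum_range_succ'] at hT
    simp only [add_zero, add_comm _ 1, ← add_assoc] at hT
    rw [hatt]
    refine haltsBy_ops _ ?_
    have hs : 0 ≤ ∑ i ∈ Finset.range k, cost (s + 1 + i) :=
      Finset.sum_nonneg fun i _ => hcost₀ _
    rw [add_comm s 1] at hs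
    have h := haltsBy_tests (s := s) (out := out)
      (p := 1 - ∏ i ∈ Finset.range k, (1 - w (s + 1 + i))) S (t₁ := t + cost s) (T := T)
      (by linarith) (fun z' t' ht' => ih (s + 1) z' t' T (by rw [add_comm s 1]; linarith))
      (ψ := Op.applyList UA UB (O s) (z • ket fun _ => false)) (t := t + Op.costList τ (O s))
      (by linarith [hcost s])
    refine h.mono ?_
    have e : projList S (Op.applyList UA UB (O s) (z • ket fun _ => false)) =
        z • projList S (Op.applyList UA UB (O s) (ket fun _ => false)) := by
      funext x
      simp [projList, Op.applyList_smul]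
    rw [e, Op.applyList_smul, l2norm_smul, l2norm_smul, mul_pow, mul_pow, hw, hnorm,
      Finset.prod_range_succ']
    simp only [add_zero, add_comm _ 1, ← add_assoc]
    -- This is `w + (1 - w) * (1 - Π) = 1 - (1 - w) * Π`, with `Π` the failure product of the later
    -- attempts.
    apply le_of_eq
    ring

end Weights

end Repeat

/-! ### States that encode matrices -/

/-- The first `a` binary digits of `i`. -/
def bits (a i : ℕ) : Fin a → Bool := fun t => Nat.testBit i t

theorem bits_zero (a : ℕ) : bits a 0 = fun _ => false := by
  funext t
  simp [bits]

theorem bits_injective (l : ℕ) : Function.Injective fun i : Fin l => bits (Nat.clog 2 l) i := by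
  intro i j h
  refine Fin.ext (Nat.eq_of_testBit_eq fun t => ?_)
  by_cases ht : t < Nat.clog 2 l
  · exact congrFun h ⟨t, ht⟩
  -- Indices below `l` have no binary digits beyond the first `Nat.clog 2 l`.
  · have hl : l ≤ 2 ^ t := (Nat.le_pow_clog one_lt_two l).trans
      (Nat.pow_le_pow_right two_pos (not_lt.1 ht))
    rw [Nat.testBit_lt_two_pow (i.2.trans_le hl), Nat.testBit_lt_two_pow (j.2.trans_le hl)]

theorem ketPair_eq (l m i j : ℕ) : ketPair l m i j = ket (Sum.elim (bits _ i) (bits _ j)) := rfl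

theorem ketPair_zero (l m : ℕ) : ketPair l m 0 0 = ket fun _ => false := by
  rw [ketPair_eq, bits_zero, bits_zero]
  congr 1
  funext t
  cases t <;> rfl

theorem ket_apply {κ : Type} [Fintype κ] [DecidableEq κ] (x y : κ → Bool) :
    ket x y = if y = x then 1 else 0 := by
  simp [ket, Pi.single_apply]

theorem mulVec_ket {κ : Type} [Fintype κ] [DecidableEq κ]
    (U : Matrix (κ → Bool) (κ → Bool) ℂ) (x y : κ → Bool) : (U.mulVec (ket x)) y = U y x := by
  simp [ket]

variable {l m n : ℕ}

theorem l2norm_sum_ket {ι κ : Type} [Fintype ι] [Fintype κ] [DecidableEq κ] {f : ι → κ → Bool}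
    (hf : Function.Injective f) (c : ι → ℂ) :
    l2norm (∑ p, c p • ket (f p)) ^ 2 = ∑ p, ‖c p‖ ^ 2 := by
  rw [l2norm_sq]
  symm
  refine Fintype.sum_of_injective f hf _ _ (fun y hy => ?_) fun p => ?_
  · have : ∀ p, ket (f p) y = 0 := fun p => by
      rw [ket_apply, if_neg fun h => hy ⟨p, h.symm⟩]
    simp [Finset.sum_apply, this]
  · classical
    simp [Finset.sum_apply, ket_apply, hf.eq_iff]

theorem frobNorm_sq (A : Matrix (Fin l) (Fin m) ℂ) : frobNorm A ^ 2 = ∑ i, ∑ j, ‖A i j‖ ^ 2 := by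
  rw [frobNorm, l2norm_sq, Fintype.sum_prod_type]

theorem frobNorm_nonneg (A : Matrix (Fin l) (Fin m) ℂ) : 0 ≤ frobNorm A := l2norm_nonneg _

theorem frobNorm_pos {A : Matrix (Fin l) (Fin m) ℂ} (hA : A ≠ 0) : 0 < frobNorm A := by
  refine lt_of_le_of_ne (frobNorm_nonneg A) fun h => hA ?_
  have := l2norm_eq_zero.1 h.symm
  ext i j
  exact congrFun this (i, j)

theorem l2norm_matrixState {A : Matrix (Fin l) (Fin m) ℂ} (hA : A ≠ 0) :
    l2norm (matrixState A) = 1 := by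
  have hinj : Function.Injective fun p : Fin l × Fin m =>
      (Sum.elim (bits (Nat.clog 2 l) p.1) (bits (Nat.clog 2 m) p.2) : Reg l m → Bool) := by
    rintro ⟨i, j⟩ ⟨i', j'⟩ h
    obtain ⟨h1, h2⟩ := Sum.elim_eq_iff.1 h
    exact Prod.ext (bits_injective l h1) (bits_injective m h2)
  have h := l2norm_sum_ket hinj fun p => A p.1 p.2 / (frobNorm A : ℂ)
  have hpos := frobNorm_pos hA
  rw [Fintype.sum_prod_type, Fintype.sum_prod_type] at h
  simp only [norm_div, Complex.norm_real, Real.norm_eq_abs, div_pow, sq_abs] at h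
  simp only [← Finset.sum_div, ← frobNorm_sq] at h
  rw [div_self (by positivity)] at h
  change l2norm (matrixState A) ^ 2 = 1 at h
  have := l2norm_nonneg (matrixState A)
  nlinarith

theorem matrixState_row_apply (B : Matrix (Fin m) (Fin n) ℂ) (j : Fin m)
    (u : Fin (Nat.clog 2 n) → Bool) :
    matrixState B (Sum.elim (bits _ j) u) =
      ∑ k, B j k / (frobNorm B : ℂ) * if u = bits _ k then 1 else 0 := by
  simp only [matrixState, ketPair_eq, Finset.sum_apply, Pi.smul_apply, smul_eq_mul, ket_apply,
    Sum.elim_eq_iff]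
  rw [Finset.sum_eq_single j]
  · simp
  · intro j' _ hj'
    have : bits (Nat.clog 2 m) j ≠ bits _ j' := fun h => hj' (bits_injective m h).symm
    simp [this]
  · simp

theorem matrixState_apply (A : Matrix (Fin l) (Fin m) ℂ) (u : Fin (Nat.clog 2 l) → Bool)
    (v : Fin (Nat.clog 2 m) → Bool) :
    matrixState A (Sum.elim u v) = ∑ i, ∑ j, A i j / (frobNorm A : ℂ) *
      ((if u = bits _ i then 1 else 0) * if v = bits _ j then 1 else 0) := by
  simp only [matrixState, ketPair_eq, Finset.sum_apply, Pi.smul_apply, smul_eq_mul, ket_apply,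
    Sum.elim_eq_iff, ite_and, ite_mul, zero_mul, one_mul]

theorem colState_apply (A : Matrix (Fin l) (Fin m) ℂ) (j : Fin m)
    (u : Fin (Nat.clog 2 l) → Bool) :
    colState A j (Sum.elim u (bits _ j)) =
      ∑ i, A i j / (l2norm (fun i' => A i' j) : ℂ) * if u = bits _ i then 1 else 0 := by
  simp [colState, ketPair_eq, Finset.sum_apply, ket_apply, Sum.elim_eq_iff]

/-- The norm of the column `j` relative to the norm of the matrix. -/
def colWeight (A : Matrix (Fin l) (Fin m) ℂ) (j : Fin m) : ℂ :=
  (l2norm (fun i' => A i' j) : ℂ) / (frobNorm A : ℂ)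

/-- The weight cancels the column normalization. For a vanishing column both sides are zero under
the convention for division by zero, so no column needs separate treatment in sums. -/
theorem colWeight_mul (A : Matrix (Fin l) (Fin m) ℂ) (i : Fin l) (j : Fin m) :
    colWeight A j * (A i j / (l2norm (fun i' => A i' j) : ℂ)) = A i j / (frobNorm A : ℂ) := by
  by_cases h : l2norm (fun i' => A i' j) = 0
  · have : A i j = 0 := congrFun (l2norm_eq_zero.1 h) i
    simp [this]
  · have h' : (l2norm (fun i' => A i' j) : ℂ) ≠ 0 := by exact_mod_cast h
    rw [colWeight]
    field_simp

theorem colWeight_eq_zero {A : Matrix (Fin l) (Fin m) ℂ} {j : Fin m} (h : ¬∃ i, A i j ≠ 0) :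
    colWeight A j = 0 := by
  push Not at h
  have : (fun i' => A i' j) = 0 := funext h
  simp [colWeight, this, l2norm_eq_zero.2 rfl]

theorem matrixState_eq_sum_colState (A : Matrix (Fin l) (Fin m) ℂ) :
    matrixState A = ∑ j, colWeight A j • colState A j := by
  simp only [colState, Finset.smul_sum, smul_smul, colWeight_mul]
  rw [Finset.sum_comm]
  rfl

/-- The column unitary sends the right-hand side to `|A⟩`: vanishing columns, where its action is
unspecified, enter with weight zero. Then invert. -/
theorem Prepares.col_adjoint_whole {UA : PrepUnitaries l m} {A : Matrix (Fin l) (Fin m) ℂ}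
    (hA : Prepares UA A) :
    (UA .col).conjTranspose.mulVec (matrixState A) = ∑ j, colWeight A j • ketPair l m 0 j := by
  have h : matrixState A = (UA .col).mulVec (∑ j, colWeight A j • ketPair l m 0 j) := by
    rw [matrixState_eq_sum_colState, Matrix.mulVec_sum]
    refine Finset.sum_congr rfl fun j _ => ?_
    rw [Matrix.mulVec_smul]
    by_cases hj : ∃ i, A i j ≠ 0
    · rw [hA.col j hj]
    · simp [colWeight_eq_zero hj]
  rw [h, Matrix.mulVec_mulVec, ← Matrix.star_eq_conjTranspose,
    Matrix.mem_unitaryGroup_iff'.1 (hA.unitary .col), Matrix.one_mulVec]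

theorem applyOn_ket_zero {κ : Type} [Fintype κ] [DecidableEq κ] {q : ℕ} (e : κ ↪ Fin q)
    (U : Matrix (κ → Bool) (κ → Bool) ℂ) (x : Fin q → Bool)
    (hx : ∀ i, (∀ k, e k ≠ i) → x i = false) : applyOn e U (ket fun _ => false) x =
      U.mulVec (ket fun _ => false) (fun k => x (e k)) := by
  rw [mulVec_ket, applyOn, Finset.sum_eq_single fun _ => false]
  · rw [ket_apply, if_pos, mul_one]
    funext i
    by_cases hi : ∃ k, e k = i
    · obtain ⟨k, rfl⟩ := hi
      rw [e.injective.extend_apply]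
    · rw [Function.extend_apply' _ _ _ hi, hx i (not_exists.1 hi)]
  · intro y _ hy
    rw [ket_apply, if_neg, mul_zero]
    intro h
    refine hy (funext fun k => ?_)
    rw [← congrFun h (e k), e.injective.extend_apply]
  · simp

theorem applyOn_ket_zero_of_ne {κ : Type} [Fintype κ] [DecidableEq κ] {q : ℕ} (e : κ ↪ Fin q)
    (U : Matrix (κ → Bool) (κ → Bool) ℂ) (x : Fin q → Bool) {i : Fin q} (hi : ∀ k, e k ≠ i)
    (hx : x i = true) : applyOn e U (ket fun _ => false) x = 0 := by
  refine Finset.sum_eq_zero fun y _ => ?_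
  rw [ket_apply, if_neg, mul_zero]
  intro h
  have := congrFun h i
  rw [Function.extend_apply' _ _ _ (not_exists.2 hi), hx] at this
  exact absurd this (by simp)

/-! ### The qubits of the algorithm -/

/-- The data qubits: a row index of `A` with a copy of the inner index, another row index of `A`
with the inner index, and a column index of `B`. -/
abbrev Data (l m n : ℕ) : Type := (Reg l m ⊕ Reg l m) ⊕ Fin (Nat.clog 2 n)

/-- The number of qubits: each data qubit has an ancilla, and there is one more ancilla. -/
def numQubits (l m n : ℕ) : ℕ := Fintype.card (Data l m n ⊕ Option (Data l m n))

/-- The enumeration of the qubits. -/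
def qubit : Data l m n ⊕ Option (Data l m n) ≃ Fin (numQubits l m n) := Fintype.equivFin _

/-- The qubits of the row index of `A`. -/
abbrev qRow (t : Fin (Nat.clog 2 l)) : Fin (numQubits l m n) := qubit (.inl (.inl (.inl (.inl t))))

/-- The qubits of the copy of the inner index. -/
abbrev qCopy (t : Fin (Nat.clog 2 m)) : Fin (numQubits l m n) := qubit (.inl (.inl (.inl (.inr t))))

/-- The qubits of the auxiliary row index. -/
abbrev qAux (t : Fin (Nat.clog 2 l)) : Fin (numQubits l m n) := qubit (.inl (.inl (.inr (.inl t))))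

/-- The qubits of the inner index. -/
abbrev qInner (t : Fin (Nat.clog 2 m)) : Fin (numQubits l m n) :=
  qubit (.inl (.inl (.inr (.inr t))))

/-- The qubits of the column index of `B`. -/
abbrev qCol (t : Fin (Nat.clog 2 n)) : Fin (numQubits l m n) := qubit (.inl (.inr t))

/-- The row index and the inner index. -/
def regA : Reg l m ↪ Fin (numQubits l m n) :=
  ⟨Sum.elim qRow qInner, by rintro (a | a) (b | b) h <;> simp at h ⊢ <;> exact h⟩

/-- The auxiliary row index and the inner index. -/
def regAux : Reg l m ↪ Fin (numQubits l m n) :=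
  ⟨Sum.elim qAux qInner, by rintro (a | a) (b | b) h <;> simp at h ⊢ <;> exact h⟩

/-- The inner index and the column index. -/
def regB : Reg m n ↪ Fin (numQubits l m n) :=
  ⟨Sum.elim qInner qCol, by rintro (a | a) (b | b) h <;> simp at h ⊢ <;> exact h⟩

/-- The row index and the column index. -/
def regOut : Reg l n ↪ Fin (numQubits l m n) :=
  ⟨Sum.elim qRow qCol, by rintro (a | a) (b | b) h <;> simp at h ⊢ <;> exact h⟩

@[simp] theorem regA_inl (t : Fin (Nat.clog 2 l)) :
    (regA (.inl t) : Fin (numQubits l m n)) = qRow t := rfl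

@[simp] theorem regA_inr (t : Fin (Nat.clog 2 m)) :
    (regA (.inr t) : Fin (numQubits l m n)) = qInner t := rfl

@[simp] theorem regAux_inl (t : Fin (Nat.clog 2 l)) :
    (regAux (.inl t) : Fin (numQubits l m n)) = qAux t := rfl

@[simp] theorem regAux_inr (t : Fin (Nat.clog 2 m)) :
    (regAux (.inr t) : Fin (numQubits l m n)) = qInner t := rfl

@[simp] theorem regB_inl (t : Fin (Nat.clog 2 m)) :
    (regB (.inl t) : Fin (numQubits l m n)) = qInner t := rfl

@[simp] theorem regB_inr (t : Fin (Nat.clog 2 n)) :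
    (regB (.inr t) : Fin (numQubits l m n)) = qCol t := rfl

@[simp] theorem regOut_inl (t : Fin (Nat.clog 2 l)) :
    (regOut (.inl t) : Fin (numQubits l m n)) = qRow t := rfl

@[simp] theorem regOut_inr (t : Fin (Nat.clog 2 n)) :
    (regOut (.inr t) : Fin (numQubits l m n)) = qCol t := rfl

/-- The circuit that adds the inner index to its copy. -/
def copyGates (l m n : ℕ) : List (BitOp (numQubits l m n)) :=
  (List.finRange (Nat.clog 2 m)).map fun t => .cnot (qInner t) (qCopy t)

theorem copyGates_valid : ∀ g ∈ copyGates l m n, g.Valid := by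
  intro g hg
  obtain ⟨t, -, rfl⟩ := List.mem_map.1 hg
  simp [BitOp.Valid]

/-- No target is a control, so the gates act independently. The membership test in the formula makes
the induction over `L` go through. -/
theorem runList_cnots {q r : ℕ} {a c : Fin r → Fin q} (hc : Function.Injective c)
    (hac : ∀ t t', a t ≠ c t') {L : List (Fin r)} (hL : L.Nodup) (x : Fin q → Bool) :
    (∀ i, (∀ t, c t ≠ i) → BitOp.runList x (L.map fun t => .cnot (a t) (c t)) i = x i) ∧
    (∀ t, BitOp.runList x (L.map fun t => .cnot (a t) (c t)) (c t) =
      xor (x (c t)) (decide (t ∈ L) && x (a t))) := by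
  induction L generalizing x with
  | nil => simp [BitOp.runList]
  | cons t₀ L ih =>
    rw [List.nodup_cons] at hL
    obtain ⟨h1, h2⟩ := ih hL.2 (BitOp.run x (.cnot (a t₀) (c t₀)))
    refine ⟨fun i hi => (h1 i hi).trans ?_, fun t => (h2 t).trans ?_⟩
    · exact BitOp.toggle_of_ne _ _ (hi t₀).symm
    · have e : BitOp.run x (.cnot (a t₀) (c t₀)) (a t) = x (a t) :=
        BitOp.toggle_of_ne _ _ (hac t t₀)
      rw [e]
      by_cases ht : t = t₀
      · subst ht
        simp [hL.1, BitOp.run, BitOp.toggle]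
      · have e' : BitOp.run x (.cnot (a t₀) (c t₀)) (c t) = x (c t) :=
          BitOp.toggle_of_ne _ _ (fun h => ht (hc h))
        rw [e']
        simp [ht]

theorem qCopy_injective : Function.Injective (qCopy : _ → Fin (numQubits l m n)) := by
  intro a b h
  simpa using h

theorem runList_copyGates (x : Fin (numQubits l m n) → Bool) :
    (∀ i, (∀ t, qCopy t ≠ i) → BitOp.runList x (copyGates l m n).reverse i = x i) ∧
    (∀ t, BitOp.runList x (copyGates l m n).reverse (qCopy t) =
      xor (x (qCopy t)) (x (qInner t))) := by
  rw [copyGates, ← List.map_reverse]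
  have h := runList_cnots (a := (qInner : _ → Fin (numQubits l m n))) (c := qCopy)
    qCopy_injective (by simp) (List.nodup_reverse.2 (List.nodup_finRange (Nat.clog 2 m))) x
  simpa using h

/-- The circuit whose success amplitude encodes the product of the matrices. -/
def mulOps (l m n : ℕ) : List (Op l m n (numQubits l m n)) :=
  .prepB .whole false regB :: BitOp.toOpsList l m n (copyGates l m n) ++
    .prepA .col false regA :: BitOp.toOpsList l m n (copyGates l m n) ++
      [.prepA .col false regAux, .prepA .whole true regAux]

/-- All qubits other than those of the output register are zero. -/
def OnlyOut (x : Fin (numQubits l m n) → Bool) : Prop :=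
  ∀ i, (∀ k, regOut k ≠ i) → x i = false

/-! ### The matrix product as a success amplitude. -/

section Amplitude

variable {UA : PrepUnitaries l m} {UB : PrepUnitaries m n} {A : Matrix (Fin l) (Fin m) ℂ}
  {B : Matrix (Fin m) (Fin n) ℂ}

theorem applyOn_copy_regB (hB : Prepares UB B) {x : Fin (numQubits l m n) → Bool} {v}
    (hrow : ∀ t, x (qRow t) = false) (haux : ∀ t, x (qAux t) = false)
    (hanc : ∀ a, x (qubit (.inr a)) = false)
    (hin : ∀ t, x (qInner t) = v t) (hcopy : ∀ t, x (qCopy t) = v t) :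
    Op.applyList UA UB (BitOp.toOpsList l m n (copyGates l m n))
      (applyOn regB (UB .whole) (ket fun _ => false)) x =
        matrixState B (Sum.elim v fun t => x (qCol t)) := by
  rw [BitOp.applyList_toOpsList UA UB copyGates_valid]
  obtain ⟨h1, h2⟩ := runList_copyGates x
  rw [applyOn_ket_zero, ← ketPair_zero, hB.whole]
  · congr 1
    funext k
    rcases k with t | t
    · exact (h1 _ (by simp)).trans (hin t)
    · exact h1 _ (by simp)
  · intro i hi
    obtain ⟨s, rfl⟩ := qubit.surjective i
    rcases s with (((t | t) | (t | t)) | t) | a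
    · exact (h1 _ (by simp)).trans (hrow t)
    · rw [h2, hcopy, hin, Bool.xor_self]
    · exact (h1 _ (by simp)).trans (haux t)
    · exact absurd rfl (hi (.inl t))
    · exact absurd rfl (hi (.inr t))
    · exact (h1 _ (by simp)).trans (hanc a)

theorem applyOn_copy_regB_of_row {x : Fin (numQubits l m n) → Bool} {t}
    (ht : x (qRow t) = true) :
    Op.applyList UA UB (BitOp.toOpsList l m n (copyGates l m n))
      (applyOn regB (UB .whole) (ket fun _ => false)) x = 0 := by
  rw [BitOp.applyList_toOpsList UA UB copyGates_valid]
  refine applyOn_ket_zero_of_ne _ _ _ (i := qRow t) (by simp) ?_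
  rw [(runList_copyGates x).1 _ (by simp), ht]

/-- After copying, only states whose copy register agrees with the inner index occur. This rules out
stray inputs to the column unitary. -/
theorem applyOn_copy_regB_of_copy {x : Fin (numQubits l m n) → Bool} {t}
    (ht : x (qCopy t) ≠ x (qInner t)) :
    Op.applyList UA UB (BitOp.toOpsList l m n (copyGates l m n))
      (applyOn regB (UB .whole) (ket fun _ => false)) x = 0 := by
  rw [BitOp.applyList_toOpsList UA UB copyGates_valid]
  refine applyOn_ket_zero_of_ne _ _ _ (i := qCopy t) (by simp) ?_
  rw [(runList_copyGates x).2]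
  simpa using ht

/-- Of all inputs to the column unitary, the only one with nonzero amplitude has row register zero
and inner index equal to the copy, that is `j`. Only its specified action on `|0⟩|j⟩` is therefore
used. -/
theorem amplitude_after_col (hA : Prepares UA A) (hB : Prepares UB B) {j : Fin m}
    (hj : ∃ i, A i j ≠ 0) {x : Fin (numQubits l m n) → Bool}
    (haux : ∀ t, x (qAux t) = false) (hanc : ∀ a, x (qubit (.inr a)) = false)
    (hin : ∀ t, x (qInner t) = bits _ j t) (hcopy : ∀ t, x (qCopy t) = bits _ j t) :
    applyOn regA (UA .col) (Op.applyList UA UB (BitOp.toOpsList l m n (copyGates l m n))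
      (applyOn regB (UB .whole) (ket fun _ => false))) x =
      colState A j (Sum.elim (fun t => x (qRow t)) (bits _ j)) *
        matrixState B (Sum.elim (bits _ j) fun t => x (qCol t)) := by
  have hx : (fun k => x (regA k)) = Sum.elim (fun t => x (qRow t)) (bits _ j) := by
    funext k
    rcases k with t | t
    · rfl
    · exact hin t
  have hext : ∀ (y : Reg l m → Bool) k, Function.extend regA y x (regA k) = y k :=
    fun y k => regA.injective.extend_apply y x k
  have hext' : ∀ (y : Reg l m → Bool) i, (∀ k, regA k ≠ i) → Function.extend regA y x i = x i :=
    fun y i hi => Function.extend_apply' _ _ _ (not_exists.2 hi)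
  rw [applyOn, hx, Finset.sum_eq_single (Sum.elim (bits _ 0) (bits _ j))]
  · rw [← hA.col j hj, ketPair_eq, mulVec_ket, applyOn_copy_regB hB (v := bits _ j)]
    · congr 3
      funext t
      exact hext' _ _ (by simp)
    · intro t
      exact (hext _ (.inl t)).trans (by simp [bits])
    · intro t
      rw [hext' _ _ (by simp), haux]
    · intro a
      rw [hext' _ _ (by simp), hanc]
    · intro t
      exact hext _ (.inr t)
    · intro t
      rw [hext' _ _ (by simp), hcopy]
  · intro y _ hy
    obtain ⟨k, hk⟩ := Function.ne_iff.1 hy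
    rcases k with t | t
    · rw [applyOn_copy_regB_of_row (t := t), mul_zero]
      refine (hext _ (.inl t)).trans ?_
      simpa [bits] using hk
    -- The copy register lies outside `regA` and still holds `j`, so an input with another inner
    -- index has amplitude zero.
    · rw [applyOn_copy_regB_of_copy (t := t), mul_zero]
      rw [hext' _ _ (by simp), hcopy]
      exact fun h => hk ((hext y (.inr t)).symm.trans h.symm)
  · simp

/-- This is the adjoint of `col_adjoint_whole`; the weights are real, so conjugation leaves them
unchanged. -/
theorem Prepares.whole_adjoint_col (hA : Prepares UA A) (y : Reg l m → Bool) :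
    ((UA .whole).conjTranspose * UA .col) (fun _ => false) y =
      ∑ j, colWeight A j * if y = Sum.elim (bits _ 0) (bits _ j) then 1 else 0 := by
  have h : ((UA .col).conjTranspose * UA .whole) y (fun _ => false) =
      ∑ j, colWeight A j * if y = Sum.elim (bits _ 0) (bits _ j) then 1 else 0 := by
    rw [← mulVec_ket ((UA .col).conjTranspose * UA .whole), ← Matrix.mulVec_mulVec, ← ketPair_zero, hA.whole, hA.col_adjoint_whole]
    simp [Finset.sum_apply, ketPair_eq, ket_apply]
  have h' := congrArg star h
  rw [← Matrix.conjTranspose_apply, Matrix.conjTranspose_mul, Matrix.conjTranspose_conjTranspose]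
    at h'
  rw [h', star_sum]
  refine Finset.sum_congr rfl fun j _ => ?_
  simp only [colWeight, star_mul', star_div₀, Complex.star_def, Complex.conj_ofReal]
  split_ifs <;> simp

/-- The amplitudes of the successful part of the state prepared by `mulOps`. -/
theorem amplitude_mulOps (hA : Prepares UA A) (hB : Prepares UB B) (hAB : A * B ≠ 0)
    {x : Fin (numQubits l m n) → Bool} (hx : OnlyOut x) :
    Op.applyList UA UB (mulOps l m n) (ket fun _ => false) x =
      (frobNorm (A * B) / (frobNorm A * frobNorm B) : ℂ) *
        matrixState (A * B) (fun k => x (regOut k)) := by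
  have haux : (fun k => x (regAux k)) = fun _ => false := by
    funext k
    refine hx _ ?_
    rcases k with t | t <;> simp
  have hext : ∀ (y : Reg l m → Bool) k, Function.extend regAux y x (regAux k) = y k :=
    fun y k => regAux.injective.extend_apply y x k
  have hext' : ∀ (y : Reg l m → Bool) i, (∀ k, regAux k ≠ i) →
      Function.extend regAux y x i = x i :=
    fun y i hi => Function.extend_apply' _ _ _ (not_exists.2 hi)
  simp only [mulOps, List.cons_append, Op.applyList_cons, Op.applyList_append, Op.applyList_nil,
    Op.apply, if_true, Bool.false_eq_true, if_false]
  -- The last two instructions merge into one matrix, of which only the row at zero matters, since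
  -- `x` vanishes on `regAux`.
  rw [applyOn_applyOn, applyOn, haux]
  simp only [hA.whole_adjoint_col, Finset.sum_mul]
  rw [Finset.sum_comm]
  simp only [mul_ite, mul_one, mul_zero, ite_mul, zero_mul, Finset.sum_ite_eq', Finset.mem_univ,
    if_true]
  have hterm : ∀ j : Fin m, colWeight A j * Op.applyList UA UB
      (BitOp.toOpsList l m n (copyGates l m n)) (applyOn regA (UA .col)
        (Op.applyList UA UB (BitOp.toOpsList l m n (copyGates l m n))
          (applyOn regB (UB .whole) (ket fun _ => false))))
      (Function.extend regAux (Sum.elim (bits _ 0) (bits _ j)) x) =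
      colWeight A j * (colState A j (Sum.elim (fun t => x (qRow t)) (bits _ j)) *
        matrixState B (Sum.elim (bits _ j) fun t => x (qCol t))) := by
    intro j
    by_cases hj : ∃ i, A i j ≠ 0
    · rw [BitOp.applyList_toOpsList UA UB copyGates_valid]
      obtain ⟨h1, h2⟩ := runList_copyGates
        (Function.extend regAux (Sum.elim (bits _ 0) (bits _ j)) x)
      have hin : ∀ t, Function.extend regAux (Sum.elim (bits _ 0) (bits _ j)) x
          (qInner t : Fin (numQubits l m n)) = bits _ j t := fun t => hext _ (.inr t)
      rw [amplitude_after_col hA hB hj]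
      · congr 3
        · congr 1
          funext t
          rw [h1 _ (by simp), hext' _ _ (by simp)]
        · congr 1
          funext t
          rw [h1 _ (by simp), hext' _ _ (by simp)]
      · intro t
        rw [h1 _ (by simp)]
        exact (hext _ (.inl t)).trans (by simp [bits])
      · intro a
        rw [h1 _ (by simp), hext' _ _ (by simp)]
        exact hx _ (by simp)
      · intro t
        rw [h1 _ (by simp), hin]
      · intro t
        rw [h2, hin, hext' _ _ (by simp), hx _ (by simp), Bool.false_xor]
    -- For a vanishing column the amplitude is unknown but is multiplied by zero.
    · rw [colWeight_eq_zero hj, zero_mul, zero_mul]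
  rw [Finset.sum_congr rfl fun j _ => hterm j]
  have hout : (fun k => x (regOut k)) = Sum.elim (fun t => x (qRow t)) fun t => x (qCol t) := by
    funext k
    rcases k with t | t <;> rfl
  have hpos : (frobNorm (A * B) : ℂ) ≠ 0 := by exact_mod_cast (frobNorm_pos hAB).ne'
  rw [hout, matrixState_apply, Finset.mul_sum]
  simp only [matrixState_row_apply, colState_apply, ← mul_assoc, Finset.mul_sum, colWeight_mul,
    Finset.sum_mul, Matrix.mul_apply, Finset.sum_div]
  rw [Finset.sum_comm, Finset.sum_congr rfl fun k _ => Finset.sum_comm, Finset.sum_comm]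
  refine Finset.sum_congr rfl fun i _ => Finset.sum_congr rfl fun k _ =>
    Finset.sum_congr rfl fun j _ => ?_
  field_simp

end Amplitude

/-! ### Amplitude amplification -/

theorem pairing_self {ι : Type} [Fintype ι] (φ : ι → ℂ) : pairing φ φ = (l2norm φ ^ 2 : ℝ) := by
  rw [l2norm_sq, pairing]
  push_cast
  refine Finset.sum_congr rfl fun x _ => ?_
  rw [Complex.star_def, Complex.conj_mul']

theorem pairing_add_right {ι : Type} [Fintype ι] (φ ψ χ : ι → ℂ) :
    pairing φ (ψ + χ) = pairing φ ψ + pairing φ χ := by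
  simp [pairing, mul_add, Finset.sum_add_distrib]

theorem pairing_smul_right {ι : Type} [Fintype ι] (φ ψ : ι → ℂ) (c : ℂ) :
    pairing φ (c • ψ) = c * pairing φ ψ := by
  simp [pairing, Finset.mul_sum, mul_left_comm]

theorem pairing_ket {κ : Type} [Fintype κ] [DecidableEq κ] (x : κ → Bool) (ψ : (κ → Bool) → ℂ) :
    pairing (ket x) ψ = ψ x := by
  simp [pairing, ket_apply]

theorem pairing_projList {q : ℕ} (S : List (Fin q)) (ψ : (Fin q → Bool) → ℂ) :
    pairing ψ (projList S ψ) = pairing (projList S ψ) (projList S ψ) := by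
  refine Finset.sum_congr rfl fun x _ => ?_
  simp only [projList]
  split_ifs <;> simp

/-- All ancillas are zero. -/
def AncZero (ψ : (Fin (numQubits l m n) → Bool) → ℂ) : Prop :=
  ∀ a : Option (Data l m n), ∀ x, x (qubit (.inr a)) = true → ψ x = 0

/-- Data qubits, each with its ancilla. -/
def withAncilla (L : List (Data l m n)) : List (Fin (numQubits l m n) × Fin (numQubits l m n)) :=
  L.map fun d => (qubit (.inl d), qubit (.inr (some d)))

theorem ladderValid_withAncilla {L : List (Data l m n)} (hL : L.Nodup) :
    BitOp.LadderValid (qubit (.inr none)) (withAncilla L) := by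
  refine ⟨List.nodup_cons.2 ⟨by simp [withAncilla], ?_⟩, fun i hi hi' => ?_⟩
  · rw [withAncilla, List.map_map]
    refine hL.map fun a b h => ?_
    simpa using h
  · simp only [withAncilla, List.map_map, List.mem_cons, List.mem_map, Function.comp_apply]
      at hi hi'
    obtain ⟨d, -, rfl⟩ := hi
    simp at hi'

/-- All data qubits. -/
def allData (l m n : ℕ) : List (Data l m n) := Finset.univ.toList

/-- The data qubit is not in the output register. -/
def isTest : Data l m n → Bool
  | .inl (.inl (.inl _)) => false
  | .inr _ => false
  | _ => true

/-- The data qubits outside the output register. -/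
def testData (l m n : ℕ) : List (Data l m n) := (allData l m n).filter isTest

/-- The qubits that are measured at the end of an attempt. -/
def testQubits (l m n : ℕ) : List (Fin (numQubits l m n)) :=
  (testData l m n).map fun d => qubit (.inl d)

theorem allData_nodup : (allData l m n).Nodup := Finset.nodup_toList _

theorem testData_nodup : (testData l m n).Nodup := allData_nodup.filter _

/-- Flip the sign of the states in which the given data qubits are zero. -/
def reflectOps (L : List (Data l m n)) : List (Op l m n (numQubits l m n)) :=
  BitOp.signOps l m n (qubit (.inr none)) (withAncilla L)

/-- One iteration of amplitude amplification. -/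
def iterOps (l m n : ℕ) : List (Op l m n (numQubits l m n)) :=
  reflectOps (testData l m n) ++ Op.invList (mulOps l m n) ++ reflectOps (allData l m n) ++
    mulOps l m n

/-- Amplitude amplification with `r` iterations. -/
def amplifyOps (l m n : ℕ) : ℕ → List (Op l m n (numQubits l m n))
  | 0 => mulOps l m n
  | r + 1 => amplifyOps l m n r ++ iterOps l m n

/-! ### The rotation, and the exactness of its successful part. -/

section Amplify

variable {UA : PrepUnitaries l m} {UB : PrepUnitaries m n} {A : Matrix (Fin l) (Fin m) ℂ}
  {B : Matrix (Fin m) (Fin n) ℂ}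

/-- The sign flip is the reflection `1 - 2P`, with `P` the projection onto zeros at `L`; clean
ancillas are what `signOps` requires. -/
theorem applyList_reflectOps {L : List (Data l m n)} (hL : L.Nodup)
    {ψ : (Fin (numQubits l m n) → Bool) → ℂ} (hψ : AncZero ψ) :
    Op.applyList UA UB (reflectOps L) ψ =
      ψ + (-2 : ℂ) • projList (L.map fun d => qubit (.inl d)) ψ := by
  rw [reflectOps, BitOp.applyList_signOps UA UB (ladderValid_withAncilla hL)]
  · funext x
    have : (withAncilla L).map Prod.fst = L.map fun d => qubit (.inl d) := by
      simp [withAncilla]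
    rw [this]
    simp only [projList, Pi.add_apply, Pi.smul_apply, smul_eq_mul]
    split_ifs <;> ring
  · intro a ha
    rcases List.mem_cons.1 ha with rfl | ha
    · exact hψ none
    · simp only [withAncilla, List.map_map, List.mem_map, Function.comp_apply] at ha
      obtain ⟨d, -, rfl⟩ := ha
      exact hψ (some d)

theorem AncZero.projList {ψ : (Fin (numQubits l m n) → Bool) → ℂ} (hψ : AncZero ψ)
    (S : List (Fin (numQubits l m n))) : AncZero (projList S ψ) := by
  intro a x hx
  simp [QMatMul.projList, hψ a x hx]

theorem AncZero.add {φ ψ : (Fin (numQubits l m n) → Bool) → ℂ} (hφ : AncZero φ)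
    (hψ : AncZero ψ) : AncZero (φ + ψ) := by
  intro a x hx
  simp [hφ a x hx, hψ a x hx]

theorem AncZero.smul {ψ : (Fin (numQubits l m n) → Bool) → ℂ} (c : ℂ) (hψ : AncZero ψ) :
    AncZero (c • ψ) := by
  intro a x hx
  simp [hψ a x hx]

theorem ancZero_ket : AncZero (ket fun _ => false : (Fin (numQubits l m n) → Bool) → ℂ) := by
  intro a x hx
  rw [ket_apply, if_neg]
  rintro rfl
  exact absurd hx (by simp)

/-- Once the ancillas are zero, vanishing data qubits leave only the basis state `|0…0⟩`. -/
theorem projList_allData {ψ : (Fin (numQubits l m n) → Bool) → ℂ} (hψ : AncZero ψ) :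
    projList ((allData l m n).map fun d => qubit (.inl d)) ψ =
      ψ (fun _ => false) • ket fun _ => false := by
  funext x
  by_cases hx : x = fun _ => false
  · subst hx
    simp [projList, ket_apply]
  · simp only [projList, Pi.smul_apply, ket_apply, if_neg hx, smul_zero, ite_eq_right_iff]
    intro h
    obtain ⟨i, hi⟩ := Function.ne_iff.1 hx
    obtain ⟨d | a, rfl⟩ := qubit.surjective i
    · exact absurd (h _ (List.mem_map.2 ⟨d, by simp [allData], rfl⟩)) hi
    · exact hψ a x (by simpa using hi)

theorem forall_mem_mulOps {p : Op l m n (numQubits l m n) → Prop}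
    (hcopy : ∀ t, ∀ o ∈ BitOp.toOps l m n (.cnot (qInner t) (qCopy t)), p o)
    (hB : p (.prepB .whole false regB)) (hA : p (.prepA .col false regA))
    (haux : p (.prepA .col false regAux)) (hinv : p (.prepA .whole true regAux)) :
    ∀ o ∈ mulOps l m n, p o := by
  have hc : ∀ o ∈ BitOp.toOpsList l m n (copyGates l m n), p o := by
    intro o ho
    obtain ⟨g, hg, ho⟩ := List.mem_flatMap.1 ho
    obtain ⟨t, -, rfl⟩ := List.mem_map.1 hg
    exact hcopy t o ho
  intro o ho
  simp only [mulOps, List.cons_append, List.mem_cons, List.mem_append, List.not_mem_nil,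
    or_false] at ho
  rcases ho with rfl | (ho | rfl | ho) | rfl | rfl
  exacts [hB, hc o ho, hA, hc o ho, haux, hinv]

theorem mulOps_isUnitary (hA : Prepares UA A) (hB : Prepares UB B) :
    ∀ o ∈ mulOps l m n, Op.IsUnitary UA UB o :=
  forall_mem_mulOps (fun t => BitOp.isUnitary_cnot UA UB (by simp)) (.prepB hB.unitary _ _ _)
    (.prepA hA.unitary _ _ _) (.prepA hA.unitary _ _ _) (.prepA hA.unitary _ _ _)

theorem mulOps_avoids (a : Option (Data l m n)) :
    ∀ o ∈ mulOps l m n, o.Avoids (qubit (.inr a)) := by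
  refine forall_mem_mulOps (fun t o ho => ?_) ?_ ?_ ?_ ?_
  · simp only [BitOp.toOps] at ho
    split_ifs at ho
    · rw [List.mem_singleton] at ho
      subst ho
      intro k
      change Fin 2 at k
      fin_cases k <;> simp
    · simp at ho
  all_goals rintro (t | t) <;> simp

theorem AncZero.mulOps {ψ : (Fin (numQubits l m n) → Bool) → ℂ} (hψ : AncZero ψ) :
    AncZero (Op.applyList UA UB (mulOps l m n) ψ) :=
  fun a => Op.applyList_eq_zero_of_avoids UA UB (mulOps_avoids a) (hψ a)

theorem AncZero.invList_mulOps {ψ : (Fin (numQubits l m n) → Bool) → ℂ} (hψ : AncZero ψ) :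
    AncZero (Op.applyList UA UB (Op.invList (QMatMul.mulOps l m n)) ψ) :=
  fun a => Op.applyList_eq_zero_of_avoids UA UB (Op.avoids_invList (mulOps_avoids a)) (hψ a)

variable (UA UB) in
/-- The state prepared by `mulOps`. -/
def mulState : (Fin (numQubits l m n) → Bool) → ℂ :=
  Op.applyList UA UB (mulOps l m n) (ket fun _ => false)

/-- Moving the circuit across the pairing turns the squared norm into that of the initial basis
state. -/
theorem l2norm_mulState (hA : Prepares UA A) (hB : Prepares UB B) :
    l2norm (mulState UA UB) = 1 := by
  have hU := mulOps_isUnitary hA hB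
  have h := Op.applyList_invList (Op.IsUnitary.invList hU) (ket fun _ => false)
  rw [Op.invList_invList] at h
  have h2 : pairing (mulState UA UB) (mulState UA UB) = 1 := by
    conv_lhs => rw [mulState, Op.pairing_applyList hU, h, pairing_ket]
    simp [ket_apply]
  rw [pairing_self] at h2
  exact (pow_eq_one_iff_of_nonneg (l2norm_nonneg _) two_ne_zero).1
    (by exact_mod_cast h2)

/-- Conjugating the reflection about `|0…0⟩` by the preparation circuit gives the reflection about
the prepared state `ψ`: `V (1 - 2|0⟩⟨0|) V⁻¹ = 1 - 2|ψ⟩⟨ψ|`. It acts after the reflection on the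
test qubits. -/
theorem applyList_iterOps (hA : Prepares UA A) (hB : Prepares UB B)
    {φ : (Fin (numQubits l m n) → Bool) → ℂ} (hφ : AncZero φ) :
    Op.applyList UA UB (iterOps l m n) φ =
      (φ + (-2 : ℂ) • projList (testQubits l m n) φ) +
        (-2 * pairing (mulState UA UB) (φ + (-2 : ℂ) • projList (testQubits l m n) φ)) •
          mulState UA UB := by
  have hU := mulOps_isUnitary hA hB
  simp only [iterOps, Op.applyList_append]
  rw [applyList_reflectOps testData_nodup hφ]
  change Op.applyList UA UB (mulOps l m n) (Op.applyList UA UB (reflectOps (allData l m n))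
    (Op.applyList UA UB (Op.invList (mulOps l m n))
      (φ + (-2 : ℂ) • projList (testQubits l m n) φ))) = _
  set φ' := φ + (-2 : ℂ) • projList (testQubits l m n) φ
  have hφ' : AncZero φ' := hφ.add ((hφ.projList _).smul _)
  rw [applyList_reflectOps allData_nodup hφ'.invList_mulOps,
    projList_allData hφ'.invList_mulOps, ← pairing_ket (fun _ => false)
      (Op.applyList UA UB (Op.invList (mulOps l m n)) φ'),
    Op.pairing_applyList (Op.IsUnitary.invList hU), Op.invList_invList, Op.applyList_add,
    Op.applyList_invList hU, smul_smul, Op.applyList_smul]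
  rfl

/-- Amplitude amplification rotates the state in the plane of its successful and its failing
part. -/
theorem applyList_amplifyOps (hA : Prepares UA A) (hB : Prepares UB B) {θ : ℝ}
    (hθ : l2norm (projList (testQubits l m n) (mulState UA UB)) = Real.sin θ) (r : ℕ) :
    ∃ α β u : ℝ, u ^ 2 = 1 ∧ α * Real.sin θ = u * Real.sin ((2 * r + 1) * θ) ∧
      β * Real.cos θ = u * Real.cos ((2 * r + 1) * θ) ∧
      Op.applyList UA UB (amplifyOps l m n r) (ket fun _ => false) =
        (α : ℂ) • projList (testQubits l m n) (mulState UA UB) +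
          (β : ℂ) • (mulState UA UB +
            (-1 : ℂ) • projList (testQubits l m n) (mulState UA UB)) := by
  have hanc : AncZero (mulState UA UB) := ancZero_ket.mulOps
  induction r with
  | zero =>
    refine ⟨1, 1, 1, by simp, by simp, by simp, ?_⟩
    simp [amplifyOps, mulState]
  | succ r ih =>
    obtain ⟨α, β, u, hu, h1, h2, h⟩ := ih
    set G := projList (testQubits l m n) (mulState UA UB) with hG
    have hGG : projList (testQubits l m n) G = G := by
      funext x
      simp only [hG, projList]
      split_ifs <;> rfl
    have hproj : projList (testQubits l m n)
        ((α : ℂ) • G + (β : ℂ) • (mulState UA UB + (-1 : ℂ) • G)) = (α : ℂ) • G := by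
      funext x
      simp only [hG, projList, Pi.add_apply, Pi.smul_apply, smul_eq_mul]
      split_ifs <;> ring
    have hp1 : pairing (mulState UA UB) G = (Real.sin θ ^ 2 : ℝ) := by
      rw [hG, pairing_projList, pairing_self, ← hG, hθ]
    have hp2 : pairing (mulState UA UB) (mulState UA UB) = 1 := by
      rw [pairing_self, l2norm_mulState hA hB]
      simp
    -- The inner expression is the overlap `p` of the prepared state with `-α G + β (ψ - G)`;
    -- subtracting `2 p ψ` gives these coefficients. Each round also contributes a global sign,
    -- recorded by `u`. The relations for `α` and `β` are multiplied by `sin θ` and `cos θ` so that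
    -- no division fails at `θ = π/2`.
    refine ⟨-(α + 2 * (-α * Real.sin θ ^ 2 + β * Real.cos θ ^ 2)),
      β - 2 * (-α * Real.sin θ ^ 2 + β * Real.cos θ ^ 2), -u, by rw [neg_sq, hu], ?_, ?_, ?_⟩
    · have e : (2 * ((r + 1 : ℕ) : ℝ) + 1) * θ = (2 * r + 1) * θ + 2 * θ := by push_cast; ring
      rw [e, Real.sin_add, Real.cos_two_mul', Real.sin_two_mul]
      have hs := Real.sin_sq_add_cos_sq θ
      linear_combination (-1 + 2 * Real.sin θ ^ 2) * h1 - 2 * Real.sin θ * Real.cos θ * h2 +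
        u * Real.sin ((2 * r + 1) * θ) * hs
    · have e : (2 * ((r + 1 : ℕ) : ℝ) + 1) * θ = (2 * r + 1) * θ + 2 * θ := by push_cast; ring
      rw [e, Real.cos_add, Real.cos_two_mul', Real.sin_two_mul]
      have hs := Real.sin_sq_add_cos_sq θ
      linear_combination (1 - 2 * Real.cos θ ^ 2) * h2 + 2 * Real.sin θ * Real.cos θ * h1 -
        u * Real.cos ((2 * r + 1) * θ) * hs
    · have hanc' : AncZero ((α : ℂ) • G + (β : ℂ) • (mulState UA UB + (-1 : ℂ) • G)) :=
        ((hanc.projList _).smul _).add ((hanc.add ((hanc.projList _).smul _)).smul _)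
      rw [amplifyOps, Op.applyList_append, h, applyList_iterOps hA hB hanc', hproj]
      simp only [pairing_add_right, pairing_smul_right, hp1, hp2]
      have hs : ((Real.cos θ ^ 2 : ℝ) : ℂ) = 1 - (Real.sin θ ^ 2 : ℝ) := by
        rw [Real.cos_sq']; push_cast; ring
      funext x
      simp only [Pi.add_apply, Pi.smul_apply, smul_eq_mul]
      push_cast at hs ⊢
      rw [hs]
      ring

/-- The successful and failing parts have disjoint supports and norms `sin θ` and `|cos θ|`, so
Pythagoras turns the coefficients into probabilities. Amplification only rescales the successful
part, so success yields the same state for every `r`. -/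
theorem l2norm_amplify (hA : Prepares UA A) (hB : Prepares UB B) {θ : ℝ}
    (hθ : l2norm (projList (testQubits l m n) (mulState UA UB)) = Real.sin θ) (r : ℕ) :
    l2norm (Op.applyList UA UB (amplifyOps l m n r) (ket fun _ => false)) = 1 ∧
    l2norm (projList (testQubits l m n)
      (Op.applyList UA UB (amplifyOps l m n r) (ket fun _ => false))) ^ 2 =
        Real.sin ((2 * r + 1) * θ) ^ 2 ∧
    ∃ c : ℂ, projList (testQubits l m n)
      (Op.applyList UA UB (amplifyOps l m n r) (ket fun _ => false)) =
        c • projList (testQubits l m n) (mulState UA UB) := by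
  obtain ⟨α, β, u, hu, h1, h2, h⟩ := applyList_amplifyOps hA hB hθ r
  set G := projList (testQubits l m n) (mulState UA UB) with hG
  have hproj : projList (testQubits l m n)
      (Op.applyList UA UB (amplifyOps l m n r) (ket fun _ => false)) = (α : ℂ) • G := by
    rw [h]
    funext x
    simp only [hG, projList, Pi.add_apply, Pi.smul_apply, smul_eq_mul]
    split_ifs <;> ring
  have hsplit : ∀ a b : ℝ, l2norm ((a : ℂ) • G + (b : ℂ) • (mulState UA UB + (-1 : ℂ) • G)) ^ 2 =
      a ^ 2 * l2norm G ^ 2 + b ^ 2 * l2norm (mulState UA UB + (-1 : ℂ) • G) ^ 2 := by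
    intro a b
    simp only [l2norm_sq, Finset.mul_sum, ← Finset.sum_add_distrib]
    refine Finset.sum_congr rfl fun x _ => ?_
    simp only [hG, projList, Pi.add_apply, Pi.smul_apply, smul_eq_mul]
    split_ifs <;> simp [mul_pow]
  have hB2 : l2norm (mulState UA UB + (-1 : ℂ) • G) ^ 2 = Real.cos θ ^ 2 := by
    have h11 := hsplit 1 1
    have e : ((1 : ℝ) : ℂ) • G + ((1 : ℝ) : ℂ) • (mulState UA UB + (-1 : ℂ) • G) =
        mulState UA UB := by
      funext x
      simp
    rw [e, l2norm_mulState hA hB, hθ] at h11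
    rw [Real.cos_sq']
    linarith
  refine ⟨?_, ?_, α, hproj⟩
  · have hn : l2norm (Op.applyList UA UB (amplifyOps l m n r) (ket fun _ => false)) ^ 2 = 1 := by
      rw [h, hsplit, hθ, hB2, ← mul_pow, ← mul_pow, h1, h2, mul_pow, mul_pow, hu, one_mul,
        one_mul, Real.sin_sq_add_cos_sq]
    exact (pow_eq_one_iff_of_nonneg (l2norm_nonneg _) two_ne_zero).1 hn
  · rw [hproj, l2norm_smul, hθ, mul_pow, Complex.norm_real, Real.norm_eq_abs, sq_abs, ← mul_pow,
      h1, mul_pow, hu, one_mul]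

/-- The qubits outside the output register. -/
abbrev NonOut (l m n : ℕ) : Type :=
  {i : Fin (numQubits l m n) // ∀ k, (regOut k : Fin (numQubits l m n)) ≠ i}

/-- The state `|M⟩` of the output register, with all other qubits zero. -/
def outState (M : Matrix (Fin l) (Fin n) ℂ) : (Fin (numQubits l m n) → Bool) → ℂ :=
  fun x => matrixState M (fun k => x (regOut k)) *
    ket (fun _ => false) (fun i : NonOut l m n => x i)

theorem outState_apply (M : Matrix (Fin l) (Fin n) ℂ) (x : Fin (numQubits l m n) → Bool)
    [Decidable (OnlyOut x)] :
    outState M x = if OnlyOut x then matrixState M (fun k => x (regOut k)) else 0 := by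
  rw [outState, ket_apply]
  have : ((fun i : NonOut l m n => x i) = fun _ => false) ↔ OnlyOut x := by
    simp [funext_iff, OnlyOut]
  simp only [this]
  split_ifs <;> simp

theorem l2norm_outState {M : Matrix (Fin l) (Fin n) ℂ} (hM : M ≠ 0) :
    l2norm (outState M : (Fin (numQubits l m n) → Bool) → ℂ) = 1 := by
  classical
  have h : l2norm (outState M : (Fin (numQubits l m n) → Bool) → ℂ) ^ 2 =
      l2norm (matrixState M) ^ 2 := by
    rw [l2norm_sq, l2norm_sq]
    symm
    refine Fintype.sum_of_injective
      (fun y => Function.extend (regOut (m := m)) y fun _ => false) ?_ _ _ ?_ ?_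
    · intro y z hyz
      funext k
      have := congrFun hyz (regOut k)
      simpa [regOut.injective.extend_apply] using this
    · intro x hx
      rw [outState_apply, if_neg]
      · simp
      · intro ho
        refine hx ⟨fun k => x (regOut k), ?_⟩
        funext i
        by_cases hi : ∃ k, regOut k = i
        · obtain ⟨k, rfl⟩ := hi
          exact regOut.injective.extend_apply _ _ k
        · exact (Function.extend_apply' _ _ _ hi).trans (ho i (not_exists.1 hi)).symm
    · intro y
      rw [outState_apply, if_pos]
      · simp [regOut.injective.extend_apply]
      · intro i hi
        exact Function.extend_apply' _ _ _ (not_exists.2 hi)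
  rw [l2norm_matrixState hM, one_pow] at h
  exact (pow_eq_one_iff_of_nonneg (l2norm_nonneg _) two_ne_zero).1 h

/-- The phase of `z` is absorbed into the unit vector on the remaining qubits, so the distance is
zero for any `ε ≥ 0`. -/
theorem approxOn_smul_outState (M : Matrix (Fin l) (Fin n) ℂ) (hM : M ≠ 0) {ε : ℝ} (hε : 0 ≤ ε)
    (z : ℂ) : ApproxOn (regOut (m := m)) (matrixState M) ε (z • outState M) := by
  obtain ⟨u, hu, huz⟩ : ∃ u : ℂ, ‖u‖ = 1 ∧ z = ‖z‖ * u := by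
    by_cases hz : z = 0
    · exact ⟨1, by simp, by simp [hz]⟩
    · have hz' : (‖z‖ : ℂ) ≠ 0 := by simpa using hz
      exact ⟨z / ‖z‖, by simp [hz], by field_simp⟩
  refine ⟨u • ket fun _ => false, by rw [l2norm_smul, l2norm_ket, hu, one_mul], ?_⟩
  rw [l2norm_smul, l2norm_outState hM, mul_one]
  have : (fun x : Fin (numQubits l m n) → Bool => (z • outState M) x - (‖z‖ : ℂ) * (matrixState M (fun k => x (regOut k)) *
      (u • ket fun _ => false : (NonOut l m n → Bool) → ℂ)
        fun i => x i)) = 0 := by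
    funext x
    simp only [Pi.smul_apply, smul_eq_mul, outState, Pi.zero_apply]
    nth_rewrite 1 [huz]
    ring
  rw [this, l2norm_eq_zero.2 rfl]
  positivity

/-- The tested qubits and the ancillas, which the circuit never sets, are together all qubits
outside the output register. -/
theorem projList_mulState (hA : Prepares UA A) (hB : Prepares UB B) (hAB : A * B ≠ 0) :
    projList (testQubits l m n) (mulState UA UB) =
      (frobNorm (A * B) / (frobNorm A * frobNorm B) : ℂ) • outState (A * B) := by
  classical
  funext x
  rw [Pi.smul_apply, outState_apply, projList]
  by_cases hx : OnlyOut x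
  · rw [if_pos hx, if_pos, mulState, amplitude_mulOps hA hB hAB hx, smul_eq_mul]
    intro i hi
    obtain ⟨d, hd, rfl⟩ := List.mem_map.1 hi
    refine hx _ ?_
    have hd' := (List.mem_filter.1 hd).2
    rcases d with ((t | t) | (t | t)) | t <;> simp [isTest] at hd' ⊢
  · rw [if_neg hx, smul_zero, ite_eq_right_iff]
    intro h
    simp only [OnlyOut, not_forall] at hx
    obtain ⟨i, hi, hxi⟩ := hx
    obtain ⟨d | a, rfl⟩ := qubit.surjective i
    · refine absurd (h _ (List.mem_map.2 ⟨d, List.mem_filter.2 ⟨by simp [allData], ?_⟩, rfl⟩)) hxi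
      rcases d with ((t | t) | (t | t)) | t
      · exact absurd rfl (hi (.inl t))
      · rfl
      · rfl
      · rfl
      · exact absurd rfl (hi (.inr t))
    · exact ancZero_ket.mulOps a x (by simpa using hxi)

end Amplify

/-! ### The running time -/

theorem card_data (l m n : ℕ) : (Fintype.card (Data l m n)) =
    2 * Nat.clog 2 l + 2 * Nat.clog 2 m + Nat.clog 2 n := by
  simp only [Fintype.card_sum, Fintype.card_fin]
  ring

theorem numQubits_eq (l m n : ℕ) : numQubits l m n = 2 * Fintype.card (Data l m n) + 1 := by
  rw [numQubits, Fintype.card_sum, Fintype.card_option]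
  ring

theorem length_allData (l m n : ℕ) : (allData l m n).length = Fintype.card (Data l m n) := by
  simp [allData]

theorem length_testData_le (l m n : ℕ) :
    (testData l m n).length ≤ Fintype.card (Data l m n) :=
  (List.length_filter_le _ _).trans_eq (length_allData l m n)

theorem costList_mulOps_le {τ : ℝ} (hτ : 1 ≤ τ) :
    Op.costList τ (mulOps l m n) ≤ 6 * τ * numQubits l m n := by
  have h := BitOp.costList_toOpsList_le (l := l) (m := m) (n := n) τ (copyGates l m n)
  have hlen : (copyGates l m n).length = Nat.clog 2 m := by simp [copyGates]
  have hq : 2 * (Nat.clog 2 m : ℝ) + 1 ≤ numQubits l m n := by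
    rw [numQubits_eq, card_data]
    exact_mod_cast (by omega)
  have hm : (0 : ℝ) ≤ Nat.clog 2 m := by positivity
  rw [hlen] at h
  simp only [mulOps, List.cons_append, Op.costList_cons, Op.costList_append, Op.costList_nil,
    Op.cost]
  nlinarith

theorem costList_reflectOps_le (τ : ℝ) {L : List (Data l m n)}
    (hL : L.length ≤ Fintype.card (Data l m n)) :
    Op.costList τ (reflectOps L) ≤ 6 * numQubits l m n := by
  refine (BitOp.costList_signOps_le τ _ _).trans ?_
  have : ((withAncilla L).length : ℝ) + 1 ≤ numQubits l m n := by
    rw [withAncilla, List.length_map, numQubits_eq]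
    exact_mod_cast (by omega)
  linarith

theorem costList_amplifyOps_le {τ : ℝ} (hτ : 1 ≤ τ) (r : ℕ) :
    Op.costList τ (amplifyOps l m n r) ≤ (6 + 24 * r) * τ * numQubits l m n := by
  have hV := costList_mulOps_le (l := l) (m := m) (n := n) hτ
  have h1 := costList_reflectOps_le τ (length_testData_le l m n)
  have h2 := costList_reflectOps_le τ (length_allData l m n).le
  have hq : (0 : ℝ) ≤ numQubits l m n := by positivity
  induction r with
  | zero => simpa [amplifyOps] using hV
  | succ r ih =>
    simp only [amplifyOps, iterOps, Op.costList_append, Op.costList_invList]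
    push_cast
    nlinarith

/-- The time taken by an attempt, including the reset that follows it. -/
theorem cost_attempt_le {τ : ℝ} (hτ : 1 ≤ τ) (r : ℕ) :
    Op.costList τ (amplifyOps l m n r) + (testQubits l m n).length + 2 * numQubits l m n ≤
      12 * τ * numQubits l m n * (2 * r + 1) := by
  have h := costList_amplifyOps_le (l := l) (m := m) (n := n) hτ r
  have ht : ((testQubits l m n).length : ℝ) ≤ numQubits l m n := by
    have := length_testData_le l m n
    rw [testQubits, List.length_map, numQubits_eq]
    exact_mod_cast (by omega)
  have hq : (0 : ℝ) ≤ numQubits l m n := by positivity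
  nlinarith

theorem clog_le {a : ℕ} (ha : 1 ≤ a) : (Nat.clog 2 a : ℝ) ≤ 2 * Real.log a + 1 := by
  have h2 := Real.log_two_gt_d9
  have ha' : (1 : ℝ) ≤ a := by exact_mod_cast ha
  have hlog : 0 ≤ Real.log a := Real.log_nonneg ha'
  rcases Nat.eq_or_lt_of_le ha with rfl | ha1
  · simp
  -- From `2 ^ (clog - 1) < a` and `log 2 > 1/2`.
  · have h := Nat.pow_pred_clog_lt_self one_lt_two ha1
    have hpos := Nat.clog_pos one_lt_two ha1
    have h' : (2 : ℝ) ^ (Nat.clog 2 a).pred ≤ a := by exact_mod_cast h.le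
    have h3 := Real.log_le_log (by positivity) h'
    rw [Real.log_pow] at h3
    have e : (Nat.clog 2 a : ℝ) = ((Nat.clog 2 a).pred : ℝ) + 1 := by
      exact_mod_cast (Nat.succ_pred_eq_of_pos hpos).symm
    have hp : (0 : ℝ) ≤ ((Nat.clog 2 a).pred : ℝ) := by positivity
    nlinarith

/-- Excluding `l * n = 1` makes `l * m * n ≥ 2`, so the logarithm is bounded below and can absorb
additive constants. -/
theorem log_half_le {l m n : ℕ} (hl : 1 ≤ l) (hm : 1 ≤ m) (hn : 1 ≤ n) (hln : l * n ≠ 1) {ε : ℝ}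
    (hε : 0 < ε) (hε1 : ε < 1) :
    1 / 2 ≤ Real.log ((l * m * n : ℝ) / ε) ∧
    Real.log (1 / ε) ≤ Real.log ((l * m * n : ℝ) / ε) ∧
    Real.log l + Real.log m + Real.log n ≤ Real.log ((l * m * n : ℝ) / ε) := by
  have hl' : (0 : ℝ) < l := by exact_mod_cast hl
  have hm' : (0 : ℝ) < m := by exact_mod_cast hm
  have hn' : (0 : ℝ) < n := by exact_mod_cast hn
  have h2 : (2 : ℝ) ≤ l * m * n := by
    have : 2 ≤ l * n := by
      have : 0 < l * n := Nat.mul_pos hl hn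
      omega
    have : 2 ≤ l * m * n := by nlinarith
    exact_mod_cast this
  have hε' : 0 ≤ Real.log (1 / ε) := Real.log_nonneg (by rw [le_div_iff₀ hε]; linarith)
  have e : Real.log ((l * m * n : ℝ) / ε) = Real.log (l * m * n) + Real.log (1 / ε) := by
    rw [← Real.log_mul (by positivity) (by positivity), mul_one_div]
  have h3 := Real.log_le_log two_pos h2
  have h4 := Real.log_two_gt_d9
  have h5 : Real.log (l * m * n : ℝ) = Real.log l + Real.log m + Real.log n := by
    rw [Real.log_mul (by positivity) (by positivity), Real.log_mul (by positivity) (by positivity)]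
  refine ⟨by linarith, by linarith, by linarith⟩

theorem numQubits_le {l m n : ℕ} (hl : 1 ≤ l) (hm : 1 ≤ m) (hn : 1 ≤ n) (hln : l * n ≠ 1) {ε : ℝ}
    (hε : 0 < ε) (hε1 : ε < 1) :
    (numQubits l m n : ℝ) ≤ 34 * Real.log ((l * m * n : ℝ) / ε) := by
  obtain ⟨h1, -, h3⟩ := log_half_le hl hm hn hln hε hε1
  have e : (numQubits l m n : ℝ) ≤ 4 * (Nat.clog 2 l + Nat.clog 2 m + Nat.clog 2 n) + 1 := by
    rw [numQubits_eq, card_data]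
    exact_mod_cast (by omega)
  have := clog_le hl
  have := clog_le hm
  have := clog_le hn
  linarith

/-- The number of attempts with the same number of iterations. -/
def repetitions (ε : ℝ) : ℕ := ⌈Real.log (1 / ε) / Real.log (4 / 3)⌉₊

theorem log_four_thirds : 1 / 4 ≤ Real.log (4 / 3) := by
  have := Real.one_sub_inv_le_log_of_pos (show (0 : ℝ) < 4 / 3 by norm_num)
  norm_num at this ⊢
  exact this

theorem repetitions_pos {ε : ℝ} (hε : 0 < ε) (hε1 : ε < 1) : 0 < repetitions ε := by
  have := log_four_thirds
  have h : 0 < Real.log (1 / ε) := Real.log_pos (by rw [lt_div_iff₀ hε]; linarith)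
  exact Nat.ceil_pos.2 (by positivity)

theorem pow_repetitions_le {ε : ℝ} (hε : 0 < ε) : (3 / 4 : ℝ) ^ repetitions ε ≤ ε := by
  have h4 := log_four_thirds
  have h := Nat.le_ceil (Real.log (1 / ε) / Real.log (4 / 3))
  rw [div_le_iff₀ (by linarith), ← Real.log_pow] at h
  have h' := (Real.log_le_log_iff (by positivity) (by positivity)).1 h
  have e : (3 / 4 : ℝ) ^ repetitions ε = ((4 / 3 : ℝ) ^ repetitions ε)⁻¹ := by
    rw [← inv_pow]; norm_num
  rw [e, inv_le_comm₀ (by positivity) hε, ← one_div]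
  exact h'

theorem repetitions_le {ε L : ℝ} (hε : 0 < ε) (hε1 : ε < 1) (hL : 1 / 2 ≤ L)
    (h : Real.log (1 / ε) ≤ L) : (repetitions ε : ℝ) ≤ 6 * L := by
  have h4 := log_four_thirds
  have h0 : 0 ≤ Real.log (1 / ε) := Real.log_nonneg (by rw [le_div_iff₀ hε]; linarith)
  have h1 := (Nat.ceil_lt_add_one (a := Real.log (1 / ε) / Real.log (4 / 3)) (by positivity)).le
  have h2 : Real.log (1 / ε) / Real.log (4 / 3) ≤ 4 * L := by
    rw [div_le_iff₀ (by linarith)]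
    nlinarith
  unfold repetitions
  linarith

/-- Take the last `t` with `3^t θ ≤ π/2`. One more tripling exceeds `π/2`, so the angle is above
`π/6`, whose sine is `1/2`. -/
theorem exists_three_pow {θ : ℝ} (h0 : 0 < θ) (h1 : θ ≤ Real.pi / 2) :
    ∃ t : ℕ, 3 ^ t * θ ≤ Real.pi / 2 ∧ 1 / 4 ≤ Real.sin (3 ^ t * θ) ^ 2 := by
  have hex : ∃ t : ℕ, Real.pi / 2 < 3 ^ t * θ := by
    obtain ⟨t, ht⟩ := pow_unbounded_of_one_lt (Real.pi / 2 / θ) (show (1 : ℝ) < 3 by norm_num)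
    exact ⟨t, by rwa [div_lt_iff₀ h0] at ht⟩
  classical
  obtain ⟨t, ht⟩ : ∃ t, Nat.find hex = t + 1 := by
    refine Nat.exists_eq_succ_of_ne_zero fun h => ?_
    have := Nat.find_spec hex
    rw [h, pow_zero, one_mul] at this
    linarith
  have hspec := Nat.find_spec hex
  have hmin := not_lt.1 (Nat.find_min hex (m := t) (by omega))
  rw [ht, pow_succ] at hspec
  refine ⟨t, hmin, ?_⟩
  have hpi := Real.pi_pos
  have h := Real.sin_le_sin_of_le_of_le_pi_div_two (x := Real.pi / 6) (by linarith) hmin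
    (by linarith)
  rw [Real.sin_pi_div_six] at h
  nlinarith

/-- The attempts come in blocks of `R` with the same number of iterations; this sums their costs. -/
theorem sum_range_mul_div (R k : ℕ) (hR : 0 < R) (f : ℕ → ℝ) :
    ∑ i ∈ Finset.range (R * k), f (i / R) = R * ∑ t ∈ Finset.range k, f t := by
  induction k with
  | zero => simp
  | succ k ih =>
    rw [Nat.mul_succ, Finset.sum_range_add, ih, Finset.sum_range_succ, mul_add]
    congr 1
    rw [Finset.sum_congr rfl (g := fun _ => f k), Finset.sum_const, Finset.card_range,
      nsmul_eq_mul]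
    intro i hi
    rw [Nat.mul_add_div hR, Nat.div_eq_of_lt (Finset.mem_range.1 hi), add_zero]

theorem two_mul_sum_three_pow (k : ℕ) :
    2 * ∑ t ∈ Finset.range k, (3 : ℝ) ^ t = 3 ^ k - 1 := by
  induction k with
  | zero => simp
  | succ k ih => rw [Finset.sum_range_succ, mul_add, ih]; ring

/-- The floor division is exact because powers of three are odd; so this many iterations multiply
the angle by exactly `3^t`. -/
theorem two_mul_half_pred_three_pow (t : ℕ) :
    2 * (((3 ^ t - 1) / 2 : ℕ) : ℝ) + 1 = 3 ^ t := by
  obtain ⟨k, hk⟩ : Odd (3 ^ t) := Odd.pow (by decide)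
  have : (3 ^ t - 1) / 2 = k := by omega
  rw [this]
  exact_mod_cast hk.symm

/-- The instructions of the attempt `s`. -/
def attemptOps (l m n : ℕ) (ε : ℝ) (s : ℕ) : List (Op l m n (numQubits l m n)) :=
  amplifyOps l m n ((3 ^ (s / repetitions ε) - 1) / 2)

/-- The steps of the attempt `s`. -/
def attempt (l m n : ℕ) (ε : ℝ) (s : ℕ) : List (Cmd l m n (numQubits l m n)) :=
  (attemptOps l m n ε s).map .op ++ (testQubits l m n).map .test

/-! ### Correctness, success probability and cost of the whole sequence of attempts. -/

section Main

variable {UA : PrepUnitaries l m} {UB : PrepUnitaries m n} {A : Matrix (Fin l) (Fin m) ℂ}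
  {B : Matrix (Fin m) (Fin n) ℂ} {ε : ℝ}

theorem attempt_ensures (hA : Prepares UA A) (hB : Prepares UB B) (hAB : A * B ≠ 0) (hε : 0 ≤ ε)
    {θ : ℝ} (hθ : l2norm (projList (testQubits l m n) (mulState UA UB)) = Real.sin θ)
    (s : ℕ) (z : ℂ) :
    Ensures UA UB (ApproxOn (regOut (m := m)) (matrixState (A * B)) ε) (attempt l m n ε s)
      (z • ket fun _ => false) := by
  rw [attempt, ensures_ops, ensures_tests, Op.applyList_smul]
  obtain ⟨-, -, c, hc⟩ := l2norm_amplify hA hB hθ ((3 ^ (s / repetitions ε) - 1) / 2)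
  have e : ∀ φ, projList (testQubits l m n) (z • φ) = z • projList (testQubits l m n) φ := by
    intro φ
    funext x
    simp [projList]
  rw [e, attemptOps, hc, projList_mulState hA hB hAB, smul_smul, smul_smul]
  exact approxOn_smul_outState _ hAB hε _

/-- It suffices to count up to the end of the block with the good exponent `t`: that block alone
brings the failure probability to `ε`, and the geometric growth makes all earlier blocks cost less
than it. -/
theorem attempts_haltsBy (hA : Prepares UA A) (hB : Prepares UB B) (hε : 0 < ε) (hε1 : ε < 1)
    {τ : ℝ} (hτ : 1 ≤ τ) {θ : ℝ} (hθ0 : 0 < θ) (hθ1 : θ ≤ Real.pi / 2)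
    (hθ : l2norm (projList (testQubits l m n) (mulState UA UB)) = Real.sin θ) {T : ℝ}
    (hT : 36 * τ * numQubits l m n * repetitions ε / Real.sin θ ≤ T) :
    RepeatHaltsBy (attempt l m n ε) UA UB regOut τ 0 (attempt l m n ε 0)
      (ket fun _ => false) 0 (1 - ε) T := by
  obtain ⟨t, ht1, ht2⟩ := exists_three_pow hθ0 hθ1
  set R := repetitions ε with hR
  have hRpos : 0 < R := repetitions_pos hε hε1
  have hsin : 0 < Real.sin θ := Real.sin_pos_of_pos_of_lt_pi hθ0 (by linarith [Real.pi_pos])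
  have hq : (0 : ℝ) ≤ numQubits l m n := by positivity
  have key := haltsBy_attempts (UA := UA) (UB := UB) (τ := τ) (att := attempt l m n ε)
    (out := regOut)
    (O := attemptOps l m n ε) (S := testQubits l m n) (fun _ => rfl)
    (w := fun s => Real.sin (3 ^ (s / R) * θ) ^ 2)
    (cost := fun s => 12 * τ * numQubits l m n * 3 ^ (s / R))
    (fun s => (l2norm_amplify hA hB hθ _).1)
    (fun s => by rw [attemptOps, (l2norm_amplify hA hB hθ _).2.1, two_mul_half_pred_three_pow])
    (fun s => by positivity)
    (fun s => by rw [← two_mul_half_pred_three_pow]; exact cost_attempt_le hτ _)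
    (R * (t + 1)) 0 1 0 T ?_
  · rw [one_smul, norm_one, one_pow, one_mul] at key
    refine key.mono ?_
    have hprod : ∏ i ∈ Finset.range (R * (t + 1)), (1 - Real.sin (3 ^ ((0 + i) / R) * θ) ^ 2) ≤
        (3 / 4) ^ R := by
      rw [Nat.mul_succ, Finset.prod_range_add]
      have hnn : ∀ x : ℝ, 0 ≤ 1 - Real.sin x ^ 2 := fun x => by
        linarith [Real.sin_sq_le_one x]
      -- Earlier blocks may fail with certainty, so they are bounded trivially.
      have h1 : ∏ i ∈ Finset.range (R * t), (1 - Real.sin (3 ^ ((0 + i) / R) * θ) ^ 2) ≤ 1 :=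
        Finset.prod_le_one (fun i _ => hnn _) fun i _ => by
          linarith [sq_nonneg (Real.sin (3 ^ ((0 + i) / R) * θ))]
      have h2 : ∏ i ∈ Finset.range R, (1 - Real.sin (3 ^ ((0 + (R * t + i)) / R) * θ) ^ 2) ≤
          (3 / 4) ^ R := by
        refine (Finset.prod_le_prod (fun i _ => hnn _) (g := fun _ => (3 / 4 : ℝ))
          fun i hi => ?_).trans_eq
          (by rw [Finset.prod_const, Finset.card_range])
        rw [zero_add, Nat.mul_add_div hRpos, Nat.div_eq_of_lt (Finset.mem_range.1 hi), add_zero]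
        linarith
      calc _ ≤ 1 * (3 / 4 : ℝ) ^ R :=
            mul_le_mul h1 h2 (Finset.prod_nonneg fun i _ => hnn _) zero_le_one
        _ = _ := one_mul _
    linarith [pow_repetitions_le hε]
  · refine le_trans ?_ hT
    simp only [zero_add, ← Finset.mul_sum]
    rw [sum_range_mul_div R (t + 1) hRpos fun i => (3 : ℝ) ^ i]
    have h3 := two_mul_sum_three_pow (t + 1)
    -- By `sin θ ≤ θ` and the choice of `t`, `3^t sin θ ≤ π/2 ≤ 2`.
    have h4 : (3 : ℝ) ^ t ≤ 2 / Real.sin θ := by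
      rw [le_div_iff₀ hsin]
      have := Real.sin_le hθ0.le
      have := Real.pi_le_four
      have : (3 : ℝ) ^ t * Real.sin θ ≤ 3 ^ t * θ := by gcongr
      linarith
    have h5 : ∑ i ∈ Finset.range (t + 1), (3 : ℝ) ^ i ≤ 3 / Real.sin θ := by
      have e : 3 / Real.sin θ = 3 / 2 * (2 / Real.sin θ) := by ring
      rw [pow_succ] at h3
      rw [e]
      linarith
    calc 12 * τ * numQubits l m n * (R * ∑ i ∈ Finset.range (t + 1), (3 : ℝ) ^ i)
        ≤ 12 * τ * numQubits l m n * (R * (3 / Real.sin θ)) := by gcongr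
      _ = _ := by ring

end Main

end QMatMul

end

theorem mainTheorem2 :
    ∃ (C : ℝ) (k : ℕ), 0 < C ∧
      ∀ l m n : ℕ, l * n ≠ 1 → ∀ ε : ℝ, 0 < ε → ε < 1 →
        ∃ P : QMatMul.Program l m n,
          ∀ (A : Matrix (Fin l) (Fin m) ℂ) (B : Matrix (Fin m) (Fin n) ℂ), A * B ≠ 0 →
          ∀ (UA : QMatMul.PrepUnitaries l m) (UB : QMatMul.PrepUnitaries m n),
            QMatMul.Prepares UA A → QMatMul.Prepares UB B →
          ∀ τ : ℝ, 1 ≤ τ →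
            (∀ N : ℕ, ∀ c ∈ P.branches UA UB τ N, P.Halted c →
              QMatMul.ApproxOn P.out (QMatMul.matrixState (A * B)) ε c.state) ∧
            ∃ N : ℕ, 1 - ε ≤ P.haltProb UA UB τ N
              (C * τ * Real.log ((l * m * n : ℝ) / ε) ^ k *
                (QMatMul.frobNorm A * QMatMul.frobNorm B /
                  (QMatMul.frobNorm (A * B) * ε))) := by
  -- The constant is `36 * 34 * 6`: from the cost bound of `attempts_haltsBy`, the number of qubits
  -- and the number of repetitions. The last two contribute one logarithm each.
  refine ⟨7344, 2, by norm_num, fun l m n hln ε hε hε1 => ?_⟩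
  refine ⟨QMatMul.repeatProgram (QMatMul.attempt l m n ε) QMatMul.regOut,
    fun A B hAB UA UB hA hB τ hτ => ?_⟩
  have hA0 : A ≠ 0 := fun h => hAB (by rw [h, Matrix.zero_mul])
  have hB0 : B ≠ 0 := fun h => hAB (by rw [h, Matrix.mul_zero])
  have hpA := QMatMul.frobNorm_pos hA0
  have hpB := QMatMul.frobNorm_pos hB0
  have hpAB := QMatMul.frobNorm_pos hAB
  obtain ⟨hl, hm, hn⟩ : 1 ≤ l ∧ 1 ≤ m ∧ 1 ≤ n := by
    refine ⟨Nat.one_le_iff_ne_zero.2 ?_, Nat.one_le_iff_ne_zero.2 ?_,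
      Nat.one_le_iff_ne_zero.2 ?_⟩
    · rintro rfl; exact hA0 (Subsingleton.elim _ _)
    · rintro rfl; exact hA0 (Subsingleton.elim _ _)
    · rintro rfl; exact hB0 (Subsingleton.elim _ _)
  set a := QMatMul.frobNorm (A * B) / (QMatMul.frobNorm A * QMatMul.frobNorm B) with ha
  have ha0 : 0 < a := by positivity
  have hnorm : QMatMul.l2norm (QMatMul.projList (QMatMul.testQubits l m n)
      (QMatMul.mulState UA UB)) = a := by
    rw [QMatMul.projList_mulState hA hB hAB, QMatMul.l2norm_smul, QMatMul.l2norm_outState hAB,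
      mul_one, ← Complex.ofReal_mul, ← Complex.ofReal_div, Complex.norm_real, Real.norm_eq_abs,
      abs_of_pos ha0]
  -- A projection of a unit vector has norm at most one; this makes `arcsin a` the angle `θ`.
  have ha1 : a ≤ 1 := by
    have h : a ^ 2 ≤ 1 ^ 2 := by
      rw [← QMatMul.l2norm_mulState hA hB, ← hnorm, QMatMul.l2norm_sq, QMatMul.l2norm_sq]
      refine Finset.sum_le_sum fun x _ => ?_
      simp only [QMatMul.projList]
      split_ifs
      · exact le_rfl
      · simp
    exact le_of_sq_le_sq h zero_le_one
  have hsin : Real.sin (Real.arcsin a) = a := Real.sin_arcsin (by linarith) ha1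
  refine ⟨QMatMul.repeatProgram_halted
    (fun s z => QMatMul.attempt_ensures hA hB hAB hε.le (hnorm.trans hsin.symm) s z) τ, ?_⟩
  obtain ⟨hL, hLε, -⟩ := QMatMul.log_half_le hl hm hn hln hε hε1
  have hq := QMatMul.numQubits_le hl hm hn hln hε hε1
  have hR := QMatMul.repetitions_le hε hε1 hL hLε
  set L := Real.log ((l * m * n : ℝ) / ε)
  obtain ⟨N, h⟩ := QMatMul.attempts_haltsBy (T := 7344 * τ * L ^ 2 *
      (QMatMul.frobNorm A * QMatMul.frobNorm B / (QMatMul.frobNorm (A * B) * ε))) hA hB hε hε1 hτ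
    (Real.arcsin_pos.2 ha0) (Real.arcsin_le_pi_div_two a) (hnorm.trans hsin.symm) (by
      rw [hsin]
      have e : QMatMul.frobNorm A * QMatMul.frobNorm B / (QMatMul.frobNorm (A * B) * ε) =
          1 / (a * ε) := by
        rw [ha]
        field_simp
      rw [e]
      -- The algorithm has no factor `1 / ε`, its output being exact; the weaker bound of the
      -- statement follows from `ε < 1`.
      have h1 : 1 / a ≤ 1 / (a * ε) :=
        one_div_le_one_div_of_le (by positivity) (by nlinarith)
      calc 36 * τ * QMatMul.numQubits l m n * QMatMul.repetitions ε / a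
          = 36 * τ * (QMatMul.numQubits l m n * QMatMul.repetitions ε) * (1 / a) := by ring
        _ ≤ 36 * τ * ((34 * L) * (6 * L)) * (1 / (a * ε)) := by gcongr
        _ = _ := by ring)
  refine ⟨N, ?_⟩
  rw [QMatMul.Program.haltProb, QMatMul.Program.branches_eq_after]
  exact h N le_rfl
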